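/- **Setting.** Let $(\Omega,\mathcal F,P)$ be a probability space, $H$ a separable real Hilbert space, and $\xi$ a generalized Gaussian random element of $H$ with zero mean and identity covariance: a jointly Gaussian family $(\varphi,\xi)$, $\varphi\in H$, with $(\varphi,\xi)\sim N(0,\|\varphi\|^2)$, linear in $\varphi$ (almost surely). Let $\sigma(\xi)=\sigma((\varphi,\xi):\varphi\in H)$. For a symmetric Hilbert–Schmidt $k$-linear form $A$ on $H$ let $A(\xi,\dots,\xi)=\sum_{i_1,\dots,i_k}A(e_{i_1},\dots,e_{i_k})\prod_{l}\mathrm{He}_{m_l(i)}((e_l,\xi))$ (in the square mean), where $(e_l)$ is an orthonormal basis, $m_l(i)$ is the number of $j$ with $i_j=l$, and $\mathrm{He}_m$ is the $m$-th probabilists' Hermite polynomial. Every square-integrable $\sigma(\xi)$-measurable $\alpha$ has an Itô–Wiener expansion $\alpha=\sum_{k\ge0}A_k(\xi,\dots,\xi)$. For a bounded linear operator $C$ on $H$ with $\|C\|\le1$, the second-quantization operator is $$\Gamma(C)\alpha=\sum_{k\ge0}A_k(C\xi,\dots,C\xi),$$ where $A_k(C\xi,\dots,C\xi)$ denotes the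 Hermite polynomial of $\xi$ for the form $A_k(C\,\cdot,\dots,C\,\cdot)$. **Corollary 1.1.** Let $\mathfrak X$ be a Polish space, let $x:\Omega\to\mathfrak X$ be $\sigma(\xi)$-measurable, and let $\|C\|\le1$. Then there is a $\sigma(\xi)$-measurable random probability measure $\mu$ on $\mathfrak X$ such that for every bounded measurable $f:\mathfrak X\to\mathbb R$ $$\int_{\mathfrak X} f\,d\mu=\Gamma(C)f(x)\quad\text{almost surely.}$$ Moreover, suppose that $\xi'$ is a generalized Gaussian random element of $H$ on $\Omega$, equidistributed with $\xi$ and independent of it, and define $\eta$ by $(\varphi,\eta)=(\sqrt{1-CC^*}\,\varphi,\xi')+(C^*\varphi,\xi)$. Then $\mu$ is the conditional law given $\xi$ of a $\sigma(\eta)$-measurable random element $x(\eta)$ of $\mathfrak X$, characterized as follows: for every orthonormal basis $(e_j)$ of $H$, every increasing sequence of finite sets $F_n$ exhausting the index set of the basis, and all regular conditional distributions $\tilde\nu_n$ of $x$ given $\xi_n=\sum_{j\in F_n}(e_j,\xi)e_j$ (so that $\tilde\nu_n(\xi_n)(\Delta)=P(x\in\Delta\mid\xi_n)$ almost surely), the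 measures $\tilde\nu_n(\eta_n)$ with $\eta_n=\sum_{j\in F_n}(e_j,\eta)e_j$ converge weakly to $\delta_{x(\eta)}$ almost surely. -/

import Mathlib

open MeasureTheory ProbabilityTheory Filter Topology

/-- A generalized Gaussian random element of the real Hilbert space `H` with zero mean and identity
covariance: a family `ξ φ` (written `(φ, ξ)`), `φ ∈ H`, of jointly Gaussian random variables with
`(φ, ξ) ∼ N(0, ‖φ‖²)`, depending linearly on `φ` (almost surely). -/
structure IsGenGaussian {Ω : Type*} [MeasurableSpace Ω] (P : Measure Ω)
    {H : Type*} [NormedAddCommGroup H] [InnerProductSpace ℝ H] (ξ : H → Ω → ℝ) : Prop where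
  measurable : ∀ φ, Measurable (ξ φ)
  jointlyGaussian : IsGaussianProcess ξ P
  law : ∀ φ, P.map (ξ φ) = gaussianReal 0 (‖φ‖₊ ^ 2)
  linear : ∀ (a b : ℝ) (φ ψ : H),
    ξ (a • φ + b • ψ) =ᵐ[P] fun ω => a * ξ φ ω + b * ξ ψ ω

/-- The sigma-field `σ((φ, ξ), φ ∈ H)`. -/
abbrev sigmaOf {Ω H : Type*} (ξ : H → Ω → ℝ) : MeasurableSpace Ω :=
  ⨆ φ, MeasurableSpace.comap (ξ φ) inferInstance

/-- The family `g` of random variables has the sum `β` in the square mean. -/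
def HasSumL2 {Ω κ : Type*} [MeasurableSpace Ω] (P : Measure Ω) (g : κ → Ω → ℝ) (β : Ω → ℝ) :
    Prop :=
  MemLp β 2 P ∧
    Tendsto (fun s : Finset κ => eLpNorm (fun ω => ∑ i ∈ s, g i ω - β ω) 2 P) atTop (𝓝 0)

/-- A symmetric Hilbert-Schmidt `k`-linear form on a separable Hilbert space. (Orthonormal bases of
a separable space are countable, so index types in `Type` suffice.) -/
structure IsSymmHilbertSchmidt {H : Type*} [NormedAddCommGroup H] [InnerProductSpace ℝ H]
    {k : ℕ} (A : ContinuousMultilinearMap ℝ (fun _ : Fin k => H) ℝ) : Prop where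
  symm : ∀ (σ : Equiv.Perm (Fin k)) (v : Fin k → H), A (v ∘ σ) = A v
  summable : ∀ {ι : Type} (e : HilbertBasis ι ℝ H),
    Summable fun i : Fin k → ι => A (fun j => e (i j)) ^ 2

open Classical in
/-- The Hermite (Wick) product of the standard normal variables `(e_{i 1}, ξ), …, (e_{i k}, ξ)`:
the product over the distinct indices `l` among `i 1, …, i k` of `He_m ((e_l, ξ))`, where `m` is the
multiplicity of `l` and `He_m` is the `m`-th (probabilists') Hermite polynomial. -/
noncomputable def wickProduct {Ω H ι : Type*} [NormedAddCommGroup H] [InnerProductSpace ℝ H]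
    (ξ : H → Ω → ℝ) (e : HilbertBasis ι ℝ H) {k : ℕ} (i : Fin k → ι) (ω : Ω) : ℝ :=
  ∏ l ∈ Finset.univ.image i,
    Polynomial.aeval (ξ (e l) ω) (Polynomial.hermite (Finset.univ.filter fun j => i j = l).card)

/-- The random variable `β` is `A(ξ, …, ξ)`, the infinite-dimensional Hermite polynomial of `ξ`
that corresponds to the `k`-linear form `A`: in every orthonormal basis `e`,
`β = ∑ A(e_{i 1}, …, e_{i k}) :(e_{i 1}, ξ) ⋯ (e_{i k}, ξ):` in the square mean. -/
def IsHermiteValue {Ω : Type*} [MeasurableSpace Ω] (P : Measure Ω)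
    {H : Type*} [NormedAddCommGroup H] [InnerProductSpace ℝ H] (ξ : H → Ω → ℝ)
    {k : ℕ} (A : ContinuousMultilinearMap ℝ (fun _ : Fin k => H) ℝ) (β : Ω → ℝ) : Prop :=
  ∀ {ι : Type} (e : HilbertBasis ι ℝ H),
    HasSumL2 P (fun (i : Fin k → ι) ω => A (fun j => e (i j)) * wickProduct ξ e i ω) β

/-- `α = ∑ₖ A_k(ξ, …, ξ)` is an Itô–Wiener expansion of `α`: the `A_k` are symmetric
Hilbert-Schmidt forms and the series converges in the square mean. -/
def IsItoWienerExpansion {Ω : Type*} [MeasurableSpace Ω] (P : Measure Ω)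
    {H : Type*} [NormedAddCommGroup H] [InnerProductSpace ℝ H] (ξ : H → Ω → ℝ)
    (A : (k : ℕ) → ContinuousMultilinearMap ℝ (fun _ : Fin k => H) ℝ) (α : Ω → ℝ) : Prop :=
  (∀ k, IsSymmHilbertSchmidt (A k)) ∧
    ∃ a : ℕ → Ω → ℝ, (∀ k, IsHermiteValue P ξ (A k) (a k)) ∧ HasSumL2 P a α

/-- `Γ(C) α = β` (almost surely), for the second-quantization operator `Γ(C)`: the variable `α` has
an Itô–Wiener expansion, and for every expansion `α = ∑ₖ A_k(ξ, …, ξ)` one has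
`β = ∑ₖ A_k(Cξ, …, Cξ)`, the expansion with the forms `A_k(C·, …, C·)`. -/
def IsSecondQuantization {Ω : Type*} [MeasurableSpace Ω] (P : Measure Ω)
    {H : Type*} [NormedAddCommGroup H] [InnerProductSpace ℝ H] (ξ : H → Ω → ℝ)
    (C : H →L[ℝ] H) (α β : Ω → ℝ) : Prop :=
  (∃ A, IsItoWienerExpansion P ξ A α) ∧
    ∀ A, IsItoWienerExpansion P ξ A α →
      IsItoWienerExpansion P ξ (fun k => (A k).compContinuousLinearMap fun _ => C) β

/-- The generalized random element `η = S ξ' + C ξ`, that is, `(φ, η) = (S φ, ξ') + (C* φ, ξ)`, for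
a symmetric `S`. -/
noncomputable def mixture {Ω H : Type*} [NormedAddCommGroup H] [InnerProductSpace ℝ H]
    [CompleteSpace H] (S C : H →L[ℝ] H) (ξ' ξ : H → Ω → ℝ) (φ : H) (ω : Ω) : ℝ :=
  ξ' (S φ) ω + ξ (ContinuousLinearMap.adjoint C φ) ω

/-- The `H`-valued random element `∑_{j ∈ F} (e_j, ξ) e_j`. -/
noncomputable def finiteSection {Ω H ι : Type*} [NormedAddCommGroup H] [InnerProductSpace ℝ H]
    (ξ : H → Ω → ℝ) (e : HilbertBasis ι ℝ H) (F : Finset ι) (ω : Ω) : H :=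
  ∑ j ∈ F, ξ (e j) ω • e j

/-- `ν` is a regular version of the conditional distribution of `x` given `ζ`:
`ν (ζ) (Δ) = P(x ∈ Δ | ζ)` almost surely, for every measurable set `Δ`. -/
def IsCondLaw {Ω E 𝔛 : Type*} [MeasurableSpace Ω] [MeasurableSpace E] [MeasurableSpace 𝔛]
    (P : Measure Ω) (x : Ω → 𝔛) (ζ : Ω → E) (ν : Kernel E 𝔛) : Prop :=
  IsMarkovKernel ν ∧ ∀ Δ : Set 𝔛, MeasurableSet Δ →
    (fun ω => (ν (ζ ω)).real Δ) =ᵐ[P] P⟦x ⁻¹' Δ | MeasurableSpace.comap ζ inferInstance⟧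

/-- The random element `y` is `x(η)`, the result of substituting `η` for `ξ` in the functional
`x = x(ξ)`: `y` is measurable with respect to `η`, and for every orthonormal basis `e`, exhausted by
increasing finite index sets `F n`, and all regular versions `ν n` of the conditional distribution
of `x` given `ξ_n = ∑_{j ∈ F n} (e_j, ξ) e_j`, almost surely the measures `ν n (η_n)`,
`η_n = ∑_{j ∈ F n} (e_j, η) e_j`, converge weakly to the unit mass at `y`. -/
def IsSubstitution {Ω : Type*} [MeasurableSpace Ω] (P : Measure Ω)
    {H : Type*} [NormedAddCommGroup H] [InnerProductSpace ℝ H] [MeasurableSpace H]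
    {𝔛 : Type*} [TopologicalSpace 𝔛] [MeasurableSpace 𝔛]
    (ξ η : H → Ω → ℝ) (x y : Ω → 𝔛) : Prop :=
  Measurable[sigmaOf η] y ∧
    ∀ {ι : Type} (e : HilbertBasis ι ℝ H) (F : ℕ → Finset ι), Monotone F → (∀ j, ∃ n, j ∈ F n) →
      ∀ ν : ℕ → Kernel H 𝔛, (∀ n, IsCondLaw P x (finiteSection ξ e (F n)) (ν n)) →
        ∀ᵐ ω ∂P, ∀ f : BoundedContinuousFunction 𝔛 ℝ,
          Tendsto (fun n => ∫ u, f u ∂(ν n (finiteSection η e (F n) ω))) atTop (𝓝 (f (y ω)))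

/-! Since `x` is `σ(ξ)`-measurable, it is `X` applied to the path `φ ↦ (φ, ξ)` in `H → ℝ`, with `X`
measurable. Choose a self-adjoint `S` with `S² = 1 - C C*`. Then `‖C* φ‖² + ‖S φ‖² = ‖φ‖²`, so the
field `(C* φ, ξ(ω)) + (S φ, ξ(ω'))` on the product space has the law of `ξ`. The measure `μ(ω)` is
the law of `X` of this field when only `ω'` is random; integrating `f` against it is Mehler's
formula.

That Mehler's formula computes `Γ(C)` is tested on the exponentials `E_φ = exp ((φ, ξ) - ‖φ‖² / 2)`.
They are total in `L²(σ(ξ))` (`ae_eq_zero_of_integral_expVec_mul`), and `∫ E_φ A(ξ, …, ξ) = A(φ, …,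
φ)`. So a square integrable functional of `ξ` is the Hermite polynomial of a symmetric
Hilbert-Schmidt form once its integrals against all `E_φ` are the diagonal values of the form
(`isHermiteValue_of_integral`). By Cameron-Martin and Fubini, the Mehler transform of `a` integrated
against `E_φ` equals `a` integrated against `E_{Cφ}` (`integral_expVec_mul_mehler`), which turns
`A_k` into `A_k(C·, …, C·)`. The transform is an `L²` contraction, so it passes to the sum over `k`.

The same tool proves all identities of laws, including those under changed measures: exponential
moments determine the law of an almost surely linear field (`IsExpField.map_eq`). Existence of the
Itô–Wiener expansion comes from the Gram matrix of the Wick products, the orthogonality of the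
chaoses, and the fact that each `E_φ` lies in their closed span.

For the second half, `(ξ, η)` has the joint law of its product-space model, so `μ` is the
conditional law of `X(η)` given `ξ`. Weak convergence to the unit mass at `X(ξ)` is Lévy's upward
theorem on a countable base of the topology. It is a measurable event of the path, so it remains
almost sure when `η`, which has the same law, replaces `ξ`. -/

/-! ### Laws of linear fields and their exponential moments -/

/-- An almost surely linear random field with finite exponential moments. -/
structure IsExpField {Ω : Type*} [MeasurableSpace Ω] (P : Measure Ω)
    {H : Type*} [AddCommGroup H] [Module ℝ H] (U : H → Ω → ℝ) : Prop where
  measurable : ∀ φ, Measurable (U φ)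
  linear : ∀ (a b : ℝ) (φ ψ : H),
    U (a • φ + b • ψ) =ᵐ[P] fun ω => a * U φ ω + b * U ψ ω
  integrable_exp : ∀ φ, Integrable (fun ω => Real.exp (U φ ω)) P

/-- An mgf finite on the whole line extends analytically to all of `ℂ`, so agreement on the reals
forces agreement of the complex mgfs, in particular of the characteristic functions. -/
theorem map_eq_of_mgf_eq {Ω₁ Ω₂ : Type*} [MeasurableSpace Ω₁] [MeasurableSpace Ω₂]
    {P₁ : Measure Ω₁} {P₂ : Measure Ω₂} [IsFiniteMeasure P₁] [IsFiniteMeasure P₂]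
    {X : Ω₁ → ℝ} {Y : Ω₂ → ℝ} (hX : AEMeasurable X P₁) (hY : AEMeasurable Y P₂)
    (hi : ∀ t : ℝ, Integrable (fun ω => Real.exp (t * X ω)) P₁)
    (h : ∀ t : ℝ, ∫ ω, Real.exp (t * X ω) ∂P₁ = ∫ ω, Real.exp (t * Y ω) ∂P₂) :
    P₁.map X = P₂.map Y := by
  -- At `t = 0` the mgf is the total mass.
  have hmass : P₁ = 0 ↔ P₂ = 0 := by
    have h0 := h 0
    simp only [zero_mul, Real.exp_zero, integral_const, smul_eq_mul, mul_one] at h0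
    rw [← Measure.measure_univ_eq_zero, ← Measure.measure_univ_eq_zero,
      ← measureReal_eq_zero_iff, ← measureReal_eq_zero_iff, h0]
  have hset : integrableExpSet X P₁ = Set.univ := Set.eq_univ_of_forall hi
  refine Measure.ext_of_complexMGF_eq hX hY (funext fun z => ?_)
  refine eqOn_complexMGF_of_mgf' (funext h) hmass ?_
  simp [hset]

namespace IsExpField

variable {Ω : Type*} [MeasurableSpace Ω] {P : Measure Ω} {H : Type*} [AddCommGroup H] [Module ℝ H]
  {U : H → Ω → ℝ}

theorem smul (hU : IsExpField P U) (a : ℝ) (φ : H) :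
    U (a • φ) =ᵐ[P] fun ω => a * U φ ω := by
  simpa using hU.linear a 0 φ 0

theorem add (hU : IsExpField P U) (φ ψ : H) :
    U (φ + ψ) =ᵐ[P] fun ω => U φ ω + U ψ ω := by
  simpa using hU.linear 1 1 φ ψ

theorem sum (hU : IsExpField P U) {κ : Type*} (s : Finset κ) (c : κ → ℝ) (v : κ → H) :
    U (∑ i ∈ s, c i • v i) =ᵐ[P] fun ω => ∑ i ∈ s, c i * U (v i) ω := by
  classical
  induction s using Finset.induction_on with
  | empty => simpa using hU.smul 0 0
  | insert a s ha ih =>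
    rw [Finset.sum_insert ha]
    filter_upwards [hU.add (c a • v a) (∑ i ∈ s, c i • v i), hU.smul (c a) (v a), ih]
      with ω h1 h2 h3
    rw [h1, h2, h3, Finset.sum_insert ha]

theorem measurable_field (hU : IsExpField P U) : Measurable fun ω φ => U φ ω :=
  measurable_pi_lambda _ hU.measurable

/-- The law of a linear field is determined by its exponential moments. -/
theorem map_eq [IsFiniteMeasure P] (hU : IsExpField P U)
    {Ω₂ : Type*} [MeasurableSpace Ω₂] {P₂ : Measure Ω₂} [IsFiniteMeasure P₂] {V : H → Ω₂ → ℝ}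
    (hV : IsExpField P₂ V)
    (h : ∀ φ, ∫ ω, Real.exp (U φ ω) ∂P = ∫ ω, Real.exp (V φ ω) ∂P₂) :
    P.map (fun ω φ => U φ ω) = P₂.map (fun ω φ => V φ ω) := by
  -- Since `t * U φ = U (t • φ)` almost surely, the exponential moments over all `φ` contain the
  -- whole mgf of each `U φ`.
  have h1 : ∀ φ, P.map (U φ) = P₂.map (V φ) := by
    intro φ
    have e1 : ∀ t : ℝ, (fun ω => Real.exp (t * U φ ω)) =ᵐ[P] fun ω => Real.exp (U (t • φ) ω) :=
      fun t => by filter_upwards [hU.smul t φ] with ω hω; rw [hω]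
    have e2 : ∀ t : ℝ, (fun ω => Real.exp (t * V φ ω)) =ᵐ[P₂] fun ω => Real.exp (V (t • φ) ω) :=
      fun t => by filter_upwards [hV.smul t φ] with ω hω; rw [hω]
    refine map_eq_of_mgf_eq (hU.measurable φ).aemeasurable (hV.measurable φ).aemeasurable
      (fun t => (integrable_congr (e1 t)).2 (hU.integrable_exp _)) fun t => ?_
    rw [integral_congr_ae (e1 t), integral_congr_ae (e2 t), h]
  -- Cramér–Wold: by linearity, a linear functional of a finite-dimensional marginal is almost
  -- surely a single variable of the field.
  have h2 : ∀ I : Finset H, P.map (fun ω => I.restrict (U · ω)) =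
      P₂.map (fun ω => I.restrict (V · ω)) := by
    classical
    intro I
    have mU : Measurable fun ω => I.restrict (U · ω) :=
      measurable_pi_lambda _ fun i => hU.measurable i
    have mV : Measurable fun ω => I.restrict (V · ω) :=
      measurable_pi_lambda _ fun i => hV.measurable i
    refine Measure.ext_of_charFunDual (funext fun L => ?_)
    rw [charFunDual_eq_charFun_map_one, charFunDual_eq_charFun_map_one,
      Measure.map_map (by fun_prop) mU, Measure.map_map (by fun_prop) mV]
    have key : ∀ g : H → ℝ, L (I.restrict g) = ∑ i : I, L (Pi.single i 1) * g i := by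
      intro g
      conv_lhs => rw [← Finset.univ_sum_single (I.restrict g)]
      rw [map_sum]
      refine Finset.sum_congr rfl fun i _ => ?_
      have : (Pi.single i (I.restrict g i) : I → ℝ) = g i • (Pi.single i 1 : I → ℝ) := by
        rw [← Pi.single_smul]; simp
      rw [this, map_smul, smul_eq_mul, mul_comm]
    have k1 := hU.sum (Finset.univ : Finset I) (fun i => L (Pi.single i 1)) (fun i => (i : H))
    have k2 := hV.sum (Finset.univ : Finset I) (fun i => L (Pi.single i 1)) (fun i => (i : H))
    have e1 : P.map (L ∘ fun ω => I.restrict (U · ω)) =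
        P.map (U (∑ i : I, L (Pi.single i 1) • (i : H))) := by
      refine Measure.map_congr ?_
      filter_upwards [k1] with ω hω
      rw [hω]; exact key (U · ω)
    have e2 : P₂.map (L ∘ fun ω => I.restrict (V · ω)) =
        P₂.map (V (∑ i : I, L (Pi.single i 1) • (i : H))) := by
      refine Measure.map_congr ?_
      filter_upwards [k2] with ω hω
      rw [hω]; exact key (V · ω)
    rw [e1, e2, h1]
  have p1 := isProjectiveLimit_map (P := P) (X := U) hU.measurable_field.aemeasurable
  have p2 := isProjectiveLimit_map (P := P₂) (X := V) hV.measurable_field.aemeasurable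
  simp_rw [h2] at p1
  exact p1.unique p2

theorem memLp_exp (hU : IsExpField P U) (φ : H) : MemLp (fun ω => Real.exp (U φ ω)) 2 P := by
  rw [memLp_two_iff_integrable_sq (hU.measurable φ).exp.aestronglyMeasurable]
  refine (integrable_congr ?_).2 (hU.integrable_exp ((2 : ℝ) • φ))
  filter_upwards [hU.smul 2 φ] with ω hω
  rw [hω, ← Real.exp_nat_mul]; norm_num

/-- A linear field has exponential moments under a change of measure with square integrable
density, if its exponentials are square integrable. -/
theorem withDensity (hU : IsExpField P U) {D : Ω → ℝ} (hD : MemLp D 2 P) (hDm : Measurable D)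
    (hD0 : ∀ ω, 0 ≤ D ω) : IsExpField (P.withDensity fun ω => ENNReal.ofReal (D ω)) U where
  measurable := hU.measurable
  linear a b φ ψ := (withDensity_absolutelyContinuous _ _).ae_le (hU.linear a b φ ψ)
  integrable_exp φ := by
    rw [integrable_withDensity_iff_integrable_smul₀' (by fun_prop) (by simp)]
    have := hD.integrable_mul (hU.memLp_exp φ)
    refine this.congr (ae_of_all _ fun ω => ?_)
    simp [ENNReal.toReal_ofReal (hD0 ω)]

end IsExpField

theorem integral_withDensity_ofReal {Ω : Type*} [MeasurableSpace Ω] {P : Measure Ω} {D : Ω → ℝ}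
    (hDm : Measurable D) (hD0 : ∀ ω, 0 ≤ D ω) (g : Ω → ℝ) :
    ∫ ω, g ω ∂(P.withDensity fun ω => ENNReal.ofReal (D ω)) = ∫ ω, D ω * g ω ∂P := by
  rw [integral_withDensity_eq_integral_toReal_smul (by fun_prop) (by simp)]
  simp [ENNReal.toReal_ofReal (hD0 _)]

namespace IsGenGaussian

variable {Ω : Type*} [MeasurableSpace Ω] {P : Measure Ω}
  {H : Type*} [NormedAddCommGroup H] [InnerProductSpace ℝ H] {ξ : H → Ω → ℝ}

theorem integral_exp (hξ : IsGenGaussian P ξ) (φ : H) :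
    ∫ ω, Real.exp (ξ φ ω) ∂P = Real.exp (‖φ‖ ^ 2 / 2) := by
  have := mgf_gaussianReal (hξ.law φ) 1
  simpa [mgf] using this

theorem isExpField (hξ : IsGenGaussian P ξ) : IsExpField P ξ where
  measurable := hξ.measurable
  linear := hξ.linear
  integrable_exp φ := by
    -- The integral of a non-integrable function is `0` by convention, while the mgf formula gives a
    -- positive value.
    by_contra hcon
    have := hξ.integral_exp φ
    rw [integral_undef hcon] at this
    exact (Real.exp_pos _).ne this

end IsGenGaussian

/-! ### Hermite polynomials under the standard Gaussian measure -/

section HermiteGaussian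

open Polynomial

theorem integrable_pow_gaussianReal (n : ℕ) :
    Integrable (fun x : ℝ => x ^ n) (gaussianReal 0 1) := by
  rcases eq_or_ne n 0 with rfl | hn
  · simp
  · have h := (memLp_id_gaussianReal (μ := 0) (v := 1) (n : NNReal)).integrable_norm_pow hn
    refine h.mono' (by fun_prop) (ae_of_all _ fun x => ?_)
    simp

theorem integrable_polynomial_gaussianReal (p : ℝ[X]) :
    Integrable (fun x => p.eval x) (gaussianReal 0 1) := by
  simp_rw [eval_eq_sum_range]
  exact integrable_finsetSum _ fun i _ => (integrable_pow_gaussianReal i).const_mul _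

/-- Gaussian integration by parts for polynomials. -/
theorem integral_mul_polynomial_gaussianReal (p : ℝ[X]) :
    ∫ x, x * p.eval x ∂(gaussianReal 0 1) = ∫ x, (derivative p).eval x ∂(gaussianReal 0 1) := by
  have hint : ∀ q : ℝ[X], Integrable (fun x => q.eval x * gaussianPDFReal 0 1 x) := by
    intro q
    have h := integrable_polynomial_gaussianReal q
    rw [gaussianReal_of_var_ne_zero _ one_ne_zero, gaussianPDF_def] at h
    rw [integrable_withDensity_iff_integrable_smul₀' (by fun_prop) (by simp)] at h
    refine h.congr (ae_of_all _ fun x => ?_)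
    simp only [smul_eq_mul]
    rw [ENNReal.toReal_ofReal (gaussianPDFReal_nonneg _ _ _), mul_comm]
  -- The factor `x` times the Gaussian density is the derivative of minus the density.
  have hd : ∀ x, HasDerivAt (fun x => -gaussianPDFReal 0 1 x) (x * gaussianPDFReal 0 1 x) x := by
    intro x
    have h1 : HasDerivAt (fun y : ℝ => -(y - 0) ^ 2 / (2 * (1 : NNReal))) (-x) x := by
      have := (((hasDerivAt_id x).sub_const 0).pow 2).neg.div_const (2 * ((1 : NNReal) : ℝ))
      refine this.congr_deriv ?_
      simp
      ring
    have := ((h1.exp).const_mul ((√(2 * Real.pi * (1 : NNReal)))⁻¹)).neg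
    refine this.congr_deriv ?_
    simp only [gaussianPDFReal]
    ring
  have key := integral_mul_deriv_eq_deriv_mul_of_integrable
    (u := fun x => p.eval x) (v := fun x => -gaussianPDFReal 0 1 x)
    (u' := fun x => (derivative p).eval x) (v' := fun x => x * gaussianPDFReal 0 1 x)
    (fun x _ => p.hasDerivAt x) (fun x _ => hd x)
    (by
      refine (hint (X * p)).congr (ae_of_all _ fun x => ?_)
      simp; ring)
    (by
      refine (hint (derivative p)).neg.congr (ae_of_all _ fun x => ?_)
      simp)
    (by
      refine (hint p).neg.congr (ae_of_all _ fun x => ?_)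
      simp)
  rw [integral_gaussianReal_eq_integral_smul one_ne_zero,
    integral_gaussianReal_eq_integral_smul one_ne_zero]
  simp only [smul_eq_mul]
  calc _ = ∫ x, p.eval x * (x * gaussianPDFReal 0 1 x) := by congr 1; ext x; ring
    _ = _ := by
      rw [key, ← integral_neg]; congr 1; ext x; ring

/-- The `n`-th probabilists' Hermite polynomial with real coefficients. -/
noncomputable def hermiteR (n : ℕ) : ℝ[X] := (hermite n).map (Int.castRingHom ℝ)

theorem aeval_hermite (n : ℕ) (x : ℝ) : aeval x (hermite n) = (hermiteR n).eval x := by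
  rw [hermiteR, eval_map, aeval_def]; rfl

theorem hermiteR_zero : hermiteR 0 = 1 := by simp [hermiteR]

theorem hermiteR_succ (n : ℕ) :
    hermiteR (n + 1) = X * hermiteR n - derivative (hermiteR n) := by
  simp [hermiteR, hermite_succ]

theorem derivative_hermiteR_succ (n : ℕ) :
    derivative (hermiteR (n + 1)) = ((n : ℝ) + 1) • hermiteR n := by
  induction n with
  | zero => simp [hermiteR_succ, hermiteR_zero]
  | succ n ih =>
    rw [hermiteR_succ (n + 1), derivative_sub, derivative_mul, ih, derivative_X, derivative_smul,
      one_mul, hermiteR_succ n]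
    push_cast
    simp only [smul_eq_C_mul, C_add, C_1]
    ring

/-- The raising operator `X - d/dx` of `hermiteR_succ` is the Gaussian adjoint of differentiation.
-/
theorem integral_hermiteR_succ_mul (n : ℕ) (p : ℝ[X]) :
    ∫ x, (hermiteR (n + 1)).eval x * p.eval x ∂(gaussianReal 0 1) =
      ∫ x, (hermiteR n).eval x * (derivative p).eval x ∂(gaussianReal 0 1) := by
  have h := integral_mul_polynomial_gaussianReal (hermiteR n * p)
  have e : ∀ x, (hermiteR (n + 1)).eval x * p.eval x = x * (hermiteR n * p).eval x -
      (derivative (hermiteR n) * p).eval x := by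
    intro x; rw [hermiteR_succ]; simp; ring
  simp_rw [e]
  rw [integral_sub, h, ← integral_sub]
  · congr 1; ext x; simp
  · exact integrable_polynomial_gaussianReal _
  · exact integrable_polynomial_gaussianReal _
  · refine (integrable_polynomial_gaussianReal (X * (hermiteR n * p))).congr
      (ae_of_all _ fun x => ?_)
    simp
  · exact integrable_polynomial_gaussianReal _

/-- One-dimensional form of the pairing with an exponential: a Cameron-Martin density acts as a
shift by `c`. -/
theorem integral_hermiteR_add (n : ℕ) (c : ℝ) :
    ∫ x, (hermiteR n).eval (x + c) ∂(gaussianReal 0 1) = c ^ n := by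
  induction n with
  | zero => simp [hermiteR_zero]
  | succ n ih =>
    have h := integral_mul_polynomial_gaussianReal ((hermiteR n).comp (X + C c))
    have e : ∀ x, (hermiteR (n + 1)).eval (x + c) = x * ((hermiteR n).comp (X + C c)).eval x +
        c * (hermiteR n).eval (x + c) - (derivative ((hermiteR n).comp (X + C c))).eval x := by
      intro x; rw [hermiteR_succ]; simp [derivative_comp]; ring
    have i1 := integrable_polynomial_gaussianReal (X * (hermiteR n).comp (X + C c))
    have i2 := (integrable_polynomial_gaussianReal ((hermiteR n).comp (X + C c))).const_mul c
    have i3 := integrable_polynomial_gaussianReal (derivative ((hermiteR n).comp (X + C c)))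
    simp only [eval_mul, eval_X] at i1
    simp only [eval_comp, eval_add, eval_X, eval_C] at i2
    simp_rw [e]
    rw [integral_sub (by exact i1.add i2) i3, integral_add i1 i2, h, integral_const_mul, ih]
    ring

/-- Each integration by parts lowers both degrees by one at the cost of a factor `n + 1`; the base
case is `integral_hermiteR_add` at `c = 0`. -/
theorem integral_hermiteR_mul_hermiteR (m n : ℕ) :
    ∫ x, (hermiteR m).eval x * (hermiteR n).eval x ∂(gaussianReal 0 1) =
      if m = n then (n.factorial : ℝ) else 0 := by
  induction m generalizing n with
  | zero =>
    have := integral_hermiteR_add n 0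
    simp only [add_zero] at this
    simp only [hermiteR_zero, eval_one, one_mul, this]
    rcases n with _ | n <;> simp
  | succ m ih =>
    rw [integral_hermiteR_succ_mul]
    rcases n with _ | n
    · simp [hermiteR_zero]
    · rw [derivative_hermiteR_succ]
      simp only [eval_smul, smul_eq_mul]
      simp_rw [mul_left_comm _ ((n : ℝ) + 1)]
      rw [integral_const_mul, ih]
      by_cases h : m = n <;> simp [h, Nat.factorial_succ]

end HermiteGaussian

/-! ### Exponential vectors and multiplicities of multi-indices -/

/-- The normalized exponential `exp ((φ, ξ) - ‖φ‖² / 2)`. -/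
noncomputable def expVec {Ω H : Type*} [NormedAddCommGroup H] (ξ : H → Ω → ℝ) (φ : H) (ω : Ω) : ℝ :=
  Real.exp (ξ φ ω - ‖φ‖ ^ 2 / 2)

/-- The number of positions at which the multi-index `i` takes the value `l`. -/
noncomputable def indexCount {ι : Type*} {k : ℕ} (i : Fin k → ι) (l : ι) : ℕ :=
  open Classical in (Finset.univ.filter fun j => i j = l).card

section indexCount

variable {ι : Type*} {k k' : ℕ}

theorem indexCount_comp_perm (i : Fin k → ι) (σ : Equiv.Perm (Fin k)) (l : ι) :
    indexCount (i ∘ σ) l = indexCount i l := by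
  classical
  unfold indexCount
  refine Finset.card_bij (fun a _ => σ a) ?_ ?_ ?_
  · intro a ha; simpa using ha
  · intro a _ b _ h; exact σ.injective h
  · intro b hb; exact ⟨σ.symm b, by simpa using hb, by simp⟩

/-- Equal multiplicities make the fibres of `i` and `j` equinumerous; bijections between fibres glue
to a permutation. -/
theorem exists_perm_of_indexCount_eq {i j : Fin k → ι}
    (h : ∀ l, indexCount i l = indexCount j l) : ∃ σ : Equiv.Perm (Fin k), i ∘ σ = j := by
  classical
  have e : ∀ l, {a // j a = l} ≃ {a // i a = l} := fun l => by
    refine Fintype.equivOfCardEq ?_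
    rw [Fintype.card_subtype, Fintype.card_subtype]
    simpa [indexCount] using (h l).symm
  exact ⟨Equiv.ofFiberEquiv e, funext fun a => Equiv.ofFiberEquiv_map e a⟩

open Classical in
theorem sum_indexCount (i : Fin k → ι) (s : Finset ι) (hs : Finset.univ.image i ⊆ s) :
    ∑ l ∈ s, indexCount i l = k := by
  have := Finset.card_eq_sum_card_fiberwise (f := i) (s := Finset.univ) (t := s)
    (fun a _ => hs (Finset.mem_image_of_mem _ (Finset.mem_univ _)))
  simpa [indexCount] using this.symm

theorem indexCount_eq_zero {i : Fin k → ι} {l : ι} (h : ∀ a, i a ≠ l) :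
    indexCount i l = 0 := by
  classical
  unfold indexCount
  rw [Finset.card_eq_zero, Finset.filter_eq_empty_iff]
  intro a _; exact h a

-- If the multiplicities differ, both sides vanish. Otherwise the permutations form a coset of the
-- stabilizer of `i`, whose order is the product of the factorials of the multiplicities.
open Classical in
theorem card_perm_comp_eq (i j : Fin k → ι) (s : Finset ι) (hi : Finset.univ.image i ⊆ s)
    (hj : Finset.univ.image j ⊆ s) :
    ∏ l ∈ s, (if indexCount i l = indexCount j l then ((indexCount i l).factorial : ℝ) else 0)
      = Fintype.card {σ : Equiv.Perm (Fin k) // i ∘ σ = j} := by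
  by_cases h : ∀ l, indexCount i l = indexCount j l
  · obtain ⟨τ, rfl⟩ := exists_perm_of_indexCount_eq h
    have e : {σ : Equiv.Perm (Fin k) // i ∘ σ = i ∘ τ} ≃ {σ : Equiv.Perm (Fin k) // i ∘ σ = i} :=
      (Equiv.mulRight τ⁻¹).subtypeEquiv fun σ => by
        constructor
        · intro h'
          funext a
          have := congrFun h' (τ⁻¹ a)
          simpa using this
        · intro h'
          funext a
          have := congrFun h' (τ a)
          simpa using this
    rw [Fintype.card_congr e, DomMulAct.stabilizer_card']
    push_cast
    rw [← Finset.prod_subset hi]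
    · refine Finset.prod_congr rfl fun l _ => ?_
      rw [if_pos (h l), Fintype.card_subtype]; rfl
    · intro l _ hl
      have h0 : indexCount i l = 0 := indexCount_eq_zero fun a ha =>
        hl (Finset.mem_image.2 ⟨a, Finset.mem_univ _, ha⟩)
      rw [if_pos (h l), h0]; simp
  · push Not at h
    obtain ⟨l, hl⟩ := h
    have hls : l ∈ s := by
      by_contra hls
      refine hl ?_
      rw [indexCount_eq_zero fun a ha => hls (hi (Finset.mem_image.2 ⟨a, Finset.mem_univ _, ha⟩)),
        indexCount_eq_zero fun a ha => hls (hj (Finset.mem_image.2 ⟨a, Finset.mem_univ _, ha⟩))]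
    rw [Finset.prod_eq_zero hls (if_neg hl)]
    symm
    rw [Nat.cast_eq_zero, Fintype.card_eq_zero_iff]
    exact ⟨fun ⟨σ, hσ⟩ => hl (by rw [← hσ, indexCount_comp_perm])⟩

open Classical in
theorem prod_indexCount_eq_zero (i : Fin k → ι) (j : Fin k' → ι) (hk : k ≠ k') (s : Finset ι)
    (hi : Finset.univ.image i ⊆ s) (hj : Finset.univ.image j ⊆ s) :
    ∏ l ∈ s, (if indexCount i l = indexCount j l then ((indexCount i l).factorial : ℝ) else 0)
      = 0 := by
  by_contra h
  rw [← ne_eq, Finset.prod_ne_zero_iff] at h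
  refine hk ?_
  rw [← sum_indexCount i s hi, ← sum_indexCount j s hj]
  refine Finset.sum_congr rfl fun l hl => ?_
  by_contra hne
  exact h l hl (if_neg hne)

end indexCount

section wickBasic

variable {Ω H ι : Type*} [NormedAddCommGroup H] [InnerProductSpace ℝ H] {k : ℕ}

open Classical in
-- Indices outside the range of `i` contribute `He_0 = 1`. This freedom in `s` lets two Wick
-- products be written over a common index set.
theorem wickProduct_eq_prod (ξ : H → Ω → ℝ) (e : HilbertBasis ι ℝ H) (i : Fin k → ι) (ω : Ω)
    (s : Finset ι) (hs : Finset.univ.image i ⊆ s) :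
    wickProduct ξ e i ω = ∏ l ∈ s, (hermiteR (indexCount i l)).eval (ξ (e l) ω) := by
  unfold wickProduct
  rw [← Finset.prod_subset hs]
  · refine Finset.prod_congr rfl fun l _ => ?_
    rw [aeval_hermite]; rfl
  · intro l _ hl
    rw [indexCount_eq_zero fun a ha => hl (Finset.mem_image.2 ⟨a, Finset.mem_univ _, ha⟩),
      hermiteR_zero]
    simp

theorem wickProduct_comp_perm (ξ : H → Ω → ℝ) (e : HilbertBasis ι ℝ H) (i : Fin k → ι)
    (σ : Equiv.Perm (Fin k)) (ω : Ω) : wickProduct ξ e (i ∘ σ) ω = wickProduct ξ e i ω := by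
  classical
  rw [wickProduct_eq_prod ξ e i ω _ subset_rfl,
    wickProduct_eq_prod ξ e (i ∘ σ) ω (Finset.univ.image i)]
  · simp_rw [indexCount_comp_perm]
  · intro l hl
    obtain ⟨a, _, rfl⟩ := Finset.mem_image.1 hl
    exact Finset.mem_image_of_mem _ (Finset.mem_univ _)

theorem measurable_wickProduct (ξ : H → Ω → ℝ) (e : HilbertBasis ι ℝ H)
    (i : Fin k → ι) : Measurable[sigmaOf ξ] (wickProduct ξ e i) := by
  classical
  have : wickProduct ξ e i = fun ω => ∏ l ∈ Finset.univ.image i,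
      (hermiteR (indexCount i l)).eval (ξ (e l) ω) :=
    funext fun ω => wickProduct_eq_prod ξ e i _ _ subset_rfl
  rw [this]
  refine Finset.measurable_prod _ fun l _ => ?_
  refine (Polynomial.continuous _).measurable.comp ?_
  exact (comap_measurable (ξ (e l))).mono (le_iSup (fun φ => MeasurableSpace.comap (ξ φ) _) (e l))
    le_rfl

end wickBasic

/-! ### Cameron-Martin formula and inner products of Wick products -/

namespace IsGenGaussian

variable {Ω : Type*} [MeasurableSpace Ω] {P : Measure Ω} [IsProbabilityMeasure P]
  {H : Type*} [NormedAddCommGroup H] [InnerProductSpace ℝ H] {ξ : H → Ω → ℝ}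

theorem memLp_two (hξ : IsGenGaussian P ξ) (φ : H) : MemLp (ξ φ) 2 P :=
  (hξ.jointlyGaussian.hasGaussianLaw_eval φ).memLp_two

theorem integral_eq_zero (hξ : IsGenGaussian P ξ) (φ : H) : ∫ ω, ξ φ ω ∂P = 0 := by
  have := integral_map (hξ.measurable φ).aemeasurable (f := fun x : ℝ => x) (μ := P) (by fun_prop)
  rw [← this, hξ.law, integral_id_gaussianReal]

theorem variance_eq (hξ : IsGenGaussian P ξ) (φ : H) : Var[ξ φ; P] = ‖φ‖ ^ 2 := by
  have := variance_map (X := fun x : ℝ => x) (μ := P) (Y := ξ φ) (by fun_prop)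
    (hξ.measurable φ).aemeasurable
  rw [hξ.law, variance_fun_id_gaussianReal] at this
  simpa [Function.comp_def] using this.symm

theorem integral_sq (hξ : IsGenGaussian P ξ) (φ : H) : ∫ ω, ξ φ ω ^ 2 ∂P = ‖φ‖ ^ 2 := by
  rw [← hξ.variance_eq φ, variance_eq_integral (hξ.measurable φ).aemeasurable,
    hξ.integral_eq_zero]
  simp

theorem covariance_eq (hξ : IsGenGaussian P ξ) (φ ψ : H) :
    cov[ξ φ, ξ ψ; P] = inner ℝ φ ψ := by
  have h1 := variance_add (hξ.memLp_two φ) (hξ.memLp_two ψ)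
  have h2 : Var[ξ φ + ξ ψ; P] = Var[ξ (φ + ψ); P] :=
    variance_congr (by filter_upwards [hξ.isExpField.add φ ψ] with ω hω; simp [hω])
  rw [h2, hξ.variance_eq, hξ.variance_eq, hξ.variance_eq, norm_add_sq_real] at h1
  linarith

theorem iIndepFun_orthonormal (hξ : IsGenGaussian P ξ) {κ : Type*} {v : κ → H}
    (hv : Orthonormal ℝ v) (s : Finset κ) : iIndepFun (fun l : s => ξ (v l)) P := by
  refine HasGaussianLaw.iIndepFun_of_covariance_eq_zero
    ((hξ.jointlyGaussian.comp_right v).hasGaussianLaw s) fun i j hij => ?_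
  rw [hξ.covariance_eq]
  exact hv.2 (fun h => hij (Subtype.ext h))

theorem map_orthonormal (hξ : IsGenGaussian P ξ) {κ : Type*} {v : κ → H}
    (hv : Orthonormal ℝ v) (l : κ) : P.map (ξ (v l)) = gaussianReal 0 1 := by
  rw [hξ.law]
  congr
  rw [← NNReal.coe_inj]
  simp [hv.1 l]

theorem integral_prod_orthonormal (hξ : IsGenGaussian P ξ) {κ : Type*} {v : κ → H}
    (hv : Orthonormal ℝ v) (s : Finset κ) {f : κ → ℝ → ℝ} (hf : ∀ l, Measurable (f l)) :
    ∫ ω, ∏ l ∈ s, f l (ξ (v l) ω) ∂P = ∏ l ∈ s, ∫ x, f l x ∂(gaussianReal 0 1) := by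
  have h := (hξ.iIndepFun_orthonormal hv s).integral_fun_prod_comp (f := fun l : s => f l)
    (fun l => (hξ.measurable _).aemeasurable) (fun l => (hf l).aestronglyMeasurable)
  calc _ = ∫ ω, ∏ l : s, f l (ξ (v l) ω) ∂P := by
        congr 1; ext ω
        exact (Finset.prod_coe_sort s fun l => f l (ξ (v l) ω)).symm
    _ = _ := h
    _ = ∏ l : s, ∫ x, f l x ∂(gaussianReal 0 1) := by
        refine Finset.prod_congr rfl fun l _ => ?_
        rw [← hξ.map_orthonormal hv l,
          integral_map (hξ.measurable _).aemeasurable (hf l).aestronglyMeasurable]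
    _ = _ := Finset.prod_coe_sort s fun l => ∫ x, f l x ∂(gaussianReal 0 1)

theorem integrable_prod_orthonormal (hξ : IsGenGaussian P ξ) {κ : Type*} {v : κ → H}
    (hv : Orthonormal ℝ v) (s : Finset κ) {f : κ → ℝ → ℝ}
    (hf : ∀ l, Integrable (f l) (gaussianReal 0 1)) :
    Integrable (fun ω => ∏ l ∈ s, f l (ξ (v l) ω)) P := by
  have hm : Measurable fun ω (l : s) => ξ (v l) ω :=
    measurable_pi_lambda _ fun l => hξ.measurable _
  have h := (hξ.iIndepFun_orthonormal hv s).map_fun_eq_pi_map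
    (fun l => (hξ.measurable _).aemeasurable)
  simp_rw [hξ.map_orthonormal hv] at h
  have hi : Integrable (fun x : s → ℝ => ∏ l : s, f l (x l))
      (Measure.pi fun _ : s => gaussianReal 0 1) :=
    Integrable.fintype_prod fun l => hf l
  rw [← h] at hi
  refine (hi.comp_measurable hm).congr (ae_of_all _ fun ω => ?_)
  exact Finset.prod_coe_sort s fun l => f l (ξ (v l) ω)

theorem measurable_expVec (hξ : IsGenGaussian P ξ) (φ : H) : Measurable (expVec ξ φ) := by
  have := hξ.measurable φ
  unfold expVec; fun_prop

theorem memLp_expVec (hξ : IsGenGaussian P ξ) (φ : H) : MemLp (expVec ξ φ) 2 P := by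
  refine ((hξ.isExpField.memLp_exp φ).const_mul (Real.exp (-(‖φ‖ ^ 2 / 2)))).ae_eq
    (ae_of_all _ fun ω => ?_)
  simp only [expVec]
  rw [← Real.exp_add]; ring_nf

theorem integral_expVec_mul_exp (hξ : IsGenGaussian P ξ) (φ ψ : H) :
    ∫ ω, expVec ξ φ ω * Real.exp (ξ ψ ω) ∂P = Real.exp (‖ψ‖ ^ 2 / 2 + inner ℝ ψ φ) := by
  have e : (fun ω => expVec ξ φ ω * Real.exp (ξ ψ ω)) =ᵐ[P]
      fun ω => Real.exp (-(‖φ‖ ^ 2 / 2)) * Real.exp (ξ (φ + ψ) ω) := by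
    filter_upwards [hξ.isExpField.add φ ψ] with ω hω
    rw [hω, expVec, ← Real.exp_add, ← Real.exp_add]; ring_nf
  rw [integral_congr_ae e, integral_const_mul, hξ.integral_exp, ← Real.exp_add,
    norm_add_sq_real, real_inner_comm]
  ring_nf

theorem integral_expVec_mul_expVec (hξ : IsGenGaussian P ξ) (φ ψ : H) :
    ∫ ω, expVec ξ φ ω * expVec ξ ψ ω ∂P = Real.exp (inner ℝ φ ψ) := by
  have e : ∀ ω, expVec ξ φ ω * expVec ξ ψ ω =
      Real.exp (-(‖ψ‖ ^ 2 / 2)) * (expVec ξ φ ω * Real.exp (ξ ψ ω)) := by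
    intro ω
    simp only [expVec]; rw [← Real.exp_add, ← Real.exp_add, ← Real.exp_add]; ring_nf
  simp_rw [e]
  rw [integral_const_mul, hξ.integral_expVec_mul_exp, ← Real.exp_add, real_inner_comm]
  ring_nf

theorem isExpField_withDensity (hξ : IsGenGaussian P ξ) (φ : H) :
    IsExpField (P.withDensity fun ω => ENNReal.ofReal (expVec ξ φ ω)) ξ :=
  hξ.isExpField.withDensity (hξ.memLp_expVec φ) (hξ.measurable_expVec φ)
    fun _ => (Real.exp_pos _).le

theorem _root_.isFiniteMeasure_withDensity_of_memLp {Ω : Type*} [MeasurableSpace Ω]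
    {P : Measure Ω} [IsFiniteMeasure P] {D : Ω → ℝ} (hD : MemLp D 2 P) :
    IsFiniteMeasure (P.withDensity fun ω => ENNReal.ofReal (D ω)) :=
  isFiniteMeasure_withDensity_ofReal (hD.integrable (by norm_num)).2

/-- The Cameron-Martin formula. -/
theorem map_withDensity_expVec (hξ : IsGenGaussian P ξ) (φ : H) :
    (P.withDensity fun ω => ENNReal.ofReal (expVec ξ φ ω)).map (fun ω ψ => ξ ψ ω) =
      P.map (fun ω ψ => ξ ψ ω + inner ℝ ψ φ) := by
  have := isFiniteMeasure_withDensity_of_memLp (hξ.memLp_expVec φ)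
  -- Both fields are linear with exponential moments `exp (‖ψ‖² / 2 + ⟨ψ, φ⟩)`.
  refine (hξ.isExpField_withDensity φ).map_eq (V := fun ψ ω => ξ ψ ω + inner ℝ ψ φ) ?_ ?_
  · refine ⟨fun ψ => (hξ.measurable ψ).add_const _, fun a b ψ ψ' => ?_, fun ψ => ?_⟩
    · filter_upwards [hξ.linear a b ψ ψ'] with ω hω
      rw [hω, inner_add_left, real_inner_smul_left, real_inner_smul_left]; ring
    · simp_rw [Real.exp_add]
      exact (hξ.isExpField.integrable_exp ψ).mul_const _
  · intro ψ
    rw [integral_withDensity_ofReal (hξ.measurable_expVec φ) (fun _ => (Real.exp_pos _).le),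
      hξ.integral_expVec_mul_exp]
    simp_rw [Real.exp_add]
    rw [integral_mul_const, hξ.integral_exp]

theorem integral_expVec_mul (hξ : IsGenGaussian P ξ) (φ : H) {g : (H → ℝ) → ℝ}
    (hg : Measurable g) :
    ∫ ω, expVec ξ φ ω * g (fun ψ => ξ ψ ω) ∂P = ∫ ω, g (fun ψ => ξ ψ ω + inner ℝ ψ φ) ∂P := by
  rw [← integral_withDensity_ofReal (hξ.measurable_expVec φ) (fun _ => (Real.exp_pos _).le),
    ← integral_map (f := g) (φ := fun ω ψ => ξ ψ ω)
      (measurable_pi_lambda _ hξ.measurable).aemeasurable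
      hg.aestronglyMeasurable, hξ.map_withDensity_expVec,
    integral_map (measurable_pi_lambda _ fun ψ => (hξ.measurable ψ).add_const _).aemeasurable
      hg.aestronglyMeasurable]

variable {ι : Type*} {k k' : ℕ}

/-- Cameron-Martin shifts each `(e_l, ξ)` by `⟨e_l, φ⟩`. By independence the integral factors, and a
factor of multiplicity `m` gives `⟨e_l, φ⟩ ^ m`. -/
theorem integral_expVec_mul_wickProduct (hξ : IsGenGaussian P ξ) (e : HilbertBasis ι ℝ H)
    (φ : H) (i : Fin k → ι) :
    ∫ ω, expVec ξ φ ω * wickProduct ξ e i ω ∂P = ∏ j, inner ℝ (e (i j)) φ := by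
  classical
  simp_rw [wickProduct_eq_prod ξ e i _ _ subset_rfl]
  rw [hξ.integral_expVec_mul φ (g := fun z =>
    ∏ l ∈ Finset.univ.image i, (hermiteR (indexCount i l)).eval (z (e l)))]
  · rw [hξ.integral_prod_orthonormal e.orthonormal (Finset.univ.image i)
      (f := fun l x => (hermiteR (indexCount i l)).eval (x + inner ℝ (e l) φ))]
    · simp_rw [integral_hermiteR_add]
      rw [Finset.prod_comp (fun l => inner ℝ (e l) φ) i]
      rfl
    · intro l
      exact ((hermiteR (indexCount i l)).continuous.comp (by fun_prop)).measurable
  · refine Finset.measurable_prod _ fun l _ => ?_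
    exact (Polynomial.continuous _).measurable.comp (measurable_pi_apply _)

theorem sigmaOf_le (hξ : IsGenGaussian P ξ) : sigmaOf ξ ≤ ‹MeasurableSpace Ω› :=
  iSup_le fun φ => (hξ.measurable φ).comap_le

theorem integrable_wickProduct_mul (hξ : IsGenGaussian P ξ) (e : HilbertBasis ι ℝ H)
    (i : Fin k → ι) (j : Fin k' → ι) :
    Integrable (fun ω => wickProduct ξ e i ω * wickProduct ξ e j ω) P := by
  classical
  let s := Finset.univ.image i ∪ Finset.univ.image j
  simp_rw [wickProduct_eq_prod ξ e i _ s Finset.subset_union_left,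
    wickProduct_eq_prod ξ e j _ s Finset.subset_union_right, ← Finset.prod_mul_distrib]
  refine hξ.integrable_prod_orthonormal e.orthonormal s (f := fun l x =>
    (hermiteR (indexCount i l)).eval x * (hermiteR (indexCount j l)).eval x)
    fun l => ?_
  simp_rw [← Polynomial.eval_mul]
  exact integrable_polynomial_gaussianReal _

theorem memLp_wickProduct (hξ : IsGenGaussian P ξ) (e : HilbertBasis ι ℝ H)
    (i : Fin k → ι) : MemLp (wickProduct ξ e i) 2 P := by
  rw [memLp_two_iff_integrable_sq
    ((measurable_wickProduct ξ e i).mono hξ.sigmaOf_le le_rfl).aestronglyMeasurable]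
  simpa [sq] using hξ.integrable_wickProduct_mul e i i

open Classical in
theorem integral_wickProduct_mul_eq_prod (hξ : IsGenGaussian P ξ) (e : HilbertBasis ι ℝ H)
    (i : Fin k → ι) (j : Fin k' → ι) :
    ∫ ω, wickProduct ξ e i ω * wickProduct ξ e j ω ∂P =
      ∏ l ∈ Finset.univ.image i ∪ Finset.univ.image j,
        (if indexCount i l = indexCount j l then ((indexCount i l).factorial : ℝ) else 0) := by
  let s := Finset.univ.image i ∪ Finset.univ.image j
  simp_rw [wickProduct_eq_prod ξ e i _ s Finset.subset_union_left,
    wickProduct_eq_prod ξ e j _ s Finset.subset_union_right, ← Finset.prod_mul_distrib]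
  rw [hξ.integral_prod_orthonormal e.orthonormal s (f := fun l x =>
    (hermiteR (indexCount i l)).eval x * (hermiteR (indexCount j l)).eval x)]
  · refine Finset.prod_congr rfl fun l _ => ?_
    rw [integral_hermiteR_mul_hermiteR]
    split_ifs with h
    · rw [h]
    · rfl
  · intro l
    exact ((Polynomial.continuous _).mul (Polynomial.continuous _)).measurable

open Classical in
theorem integral_wickProduct_mul (hξ : IsGenGaussian P ξ) (e : HilbertBasis ι ℝ H)
    (i j : Fin k → ι) :
    ∫ ω, wickProduct ξ e i ω * wickProduct ξ e j ω ∂P =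
      Fintype.card {σ : Equiv.Perm (Fin k) // i ∘ σ = j} := by
  rw [hξ.integral_wickProduct_mul_eq_prod, card_perm_comp_eq i j _ Finset.subset_union_left
    Finset.subset_union_right]

theorem integral_wickProduct_mul_of_ne (hξ : IsGenGaussian P ξ) (e : HilbertBasis ι ℝ H)
    (i : Fin k → ι) (j : Fin k' → ι) (hk : k ≠ k') :
    ∫ ω, wickProduct ξ e i ω * wickProduct ξ e j ω ∂P = 0 := by
  classical
  rw [hξ.integral_wickProduct_mul_eq_prod, prod_indexCount_eq_zero i j hk _
    Finset.subset_union_left Finset.subset_union_right]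

end IsGenGaussian

/-! ### Hilbert space geometry of symmetric tensors -/

section FockFamily

variable {E : Type*} [NormedAddCommGroup E] [InnerProductSpace ℝ E] {ι : Type*} {k : ℕ}

open Classical in
/-- The vectors `w i`, indexed by `k`-tuples, have the Gram matrix of the symmetric tensors
`√(k!) • Sym (e_{i 1} ⊗ ⋯ ⊗ e_{i k})`. -/
structure IsFockFamily (w : (Fin k → ι) → E) : Prop where
  comp_perm : ∀ i (σ : Equiv.Perm (Fin k)), w (i ∘ σ) = w i
  inner_eq : ∀ i j, inner ℝ (w i) (w j) = ∑ σ : Equiv.Perm (Fin k), if i ∘ σ = j then (1 : ℝ) else 0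

namespace IsFockFamily

variable {w : (Fin k → ι) → E}

/-- The Gram matrix splits the squared norm into one sum per permutation, each correlating `a` with
a rearrangement of itself; `2ab ≤ a² + b²` bounds every one by `∑ a²`. -/
theorem norm_sum_sq_le (hw : IsFockFamily w) (a : (Fin k → ι) → ℝ) (s : Finset (Fin k → ι)) :
    ‖∑ i ∈ s, a i • w i‖ ^ 2 ≤ k.factorial * ∑ i ∈ s, a i ^ 2 := by
  classical
  have h1 : ‖∑ i ∈ s, a i • w i‖ ^ 2 =
      ∑ σ : Equiv.Perm (Fin k), ∑ i ∈ s, if i ∘ σ ∈ s then a i * a (i ∘ σ) else 0 := by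
    rw [← real_inner_self_eq_norm_sq, sum_inner, Finset.sum_comm]
    refine Finset.sum_congr rfl fun i _ => ?_
    rw [inner_sum]
    simp_rw [real_inner_smul_left, real_inner_smul_right, hw.inner_eq, Finset.mul_sum]
    rw [Finset.sum_comm]
    refine Finset.sum_congr rfl fun σ _ => ?_
    simp only [mul_ite, mul_one, mul_zero]
    exact Finset.sum_ite_eq s (i ∘ σ) fun j => a i * a j
  rw [h1]
  have h2 : ∀ σ : Equiv.Perm (Fin k),
      ∑ i ∈ s, (if i ∘ σ ∈ s then a i * a (i ∘ σ) else 0) ≤ ∑ i ∈ s, a i ^ 2 := by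
    intro σ
    have h3 : ∑ i ∈ s, (if i ∘ σ ∈ s then a (i ∘ σ) ^ 2 else 0) ≤ ∑ i ∈ s, a i ^ 2 := by
      rw [← Finset.sum_filter]
      have hinj : Set.InjOn (fun i : Fin k → ι => i ∘ σ) (s.filter fun i => i ∘ σ ∈ s) :=
        fun x _ y _ hxy => σ.surjective.injective_comp_right hxy
      rw [← Finset.sum_image (f := fun j => a j ^ 2) hinj]
      refine Finset.sum_le_sum_of_subset_of_nonneg ?_ fun _ _ _ => sq_nonneg _
      intro j hj
      obtain ⟨i, hi, rfl⟩ := Finset.mem_image.1 hj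
      exact (Finset.mem_filter.1 hi).2
    have h4 : ∑ i ∈ s, (if i ∘ σ ∈ s then a i * a (i ∘ σ) else 0) ≤
        ∑ i ∈ s, (a i ^ 2 / 2 + (if i ∘ σ ∈ s then a (i ∘ σ) ^ 2 else 0) / 2) := by
      refine Finset.sum_le_sum fun i _ => ?_
      split_ifs
      · nlinarith [sq_nonneg (a i - a (i ∘ σ))]
      · nlinarith [sq_nonneg (a i)]
    rw [Finset.sum_add_distrib, ← Finset.sum_div, ← Finset.sum_div] at h4
    linarith
  calc _ ≤ ∑ _σ : Equiv.Perm (Fin k), ∑ i ∈ s, a i ^ 2 := Finset.sum_le_sum fun σ _ => h2 σ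
    _ = _ := by simp [Fintype.card_perm]

theorem summable [CompleteSpace E] (hw : IsFockFamily w) {a : (Fin k → ι) → ℝ}
    (ha : Summable fun i => a i ^ 2) : Summable fun i => a i • w i := by
  rw [summable_iff_vanishing_norm] at ha ⊢
  intro ε hε
  have hk : (0 : ℝ) < k.factorial := by positivity
  obtain ⟨s, hs⟩ := ha (ε ^ 2 / k.factorial) (by positivity)
  refine ⟨s, fun t ht => ?_⟩
  have h1 := hs t ht
  rw [Real.norm_of_nonneg (Finset.sum_nonneg fun _ _ => sq_nonneg _), lt_div_iff₀ hk] at h1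
  refine lt_of_pow_lt_pow_left₀ 2 hε.le ((hw.norm_sum_sq_le a t).trans_lt ?_)
  linarith

/-- Bessel inequality dual to `norm_sum_sq_le`: pair `x` with the combination whose coefficients are
its own inner products, then cancel one factor `T`. -/
theorem sum_inner_sq_le (hw : IsFockFamily w) (x : E) (s : Finset (Fin k → ι)) :
    ∑ i ∈ s, inner ℝ x (w i) ^ 2 ≤ k.factorial * ‖x‖ ^ 2 := by
  set T := ∑ i ∈ s, inner ℝ x (w i) ^ 2 with hT
  have h1 := hw.norm_sum_sq_le (fun i => inner ℝ x (w i)) s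
  have h2 : T = inner ℝ x (∑ i ∈ s, inner ℝ x (w i) • w i) := by
    rw [inner_sum]
    simp_rw [real_inner_smul_right]
    exact Finset.sum_congr rfl fun i _ => by ring
  have h3 := abs_real_inner_le_norm x (∑ i ∈ s, inner ℝ x (w i) • w i)
  rw [← h2] at h3
  have hT0 : 0 ≤ T := Finset.sum_nonneg fun _ _ => sq_nonneg _
  rw [abs_of_nonneg hT0] at h3
  have h4 : T * T ≤ (k.factorial * ‖x‖ ^ 2) * T := by
    calc T * T ≤ (‖x‖ * ‖∑ i ∈ s, inner ℝ x (w i) • w i‖) * (‖x‖ * ‖∑ i ∈ s, inner ℝ x (w i) • w i‖) :=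
          mul_le_mul h3 h3 hT0 (by positivity)
      _ = ‖x‖ ^ 2 * ‖∑ i ∈ s, inner ℝ x (w i) • w i‖ ^ 2 := by ring
      _ ≤ ‖x‖ ^ 2 * (k.factorial * T) := by gcongr
      _ = _ := by ring
  rcases hT0.eq_or_lt with h | h
  · rw [← h]; positivity
  · exact le_of_mul_le_mul_right h4 h

theorem summable_inner_sq (hw : IsFockFamily w) (x : E) :
    Summable fun i => inner ℝ x (w i) ^ 2 :=
  summable_of_sum_le (fun _ => sq_nonneg _) (hw.sum_inner_sq_le x)

/-- Row `j` of the Gram matrix collects `k!` permuted copies of `c j`, all equal by symmetry. -/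
theorem inner_of_hasSum (hw : IsFockFamily w) {c : (Fin k → ι) → ℝ}
    (hc : ∀ i (σ : Equiv.Perm (Fin k)), c (i ∘ σ) = c i) {x : E}
    (hx : HasSum (fun i => c i • w i) x) (j : Fin k → ι) :
    inner ℝ x (w j) = k.factorial * c j := by
  classical
  have h1 : HasSum (fun i => inner ℝ (w j) (c i • w i)) (inner ℝ (w j) x) :=
    hx.mapL (innerSL ℝ (w j))
  have h2 : HasSum (fun i => ∑ σ : Equiv.Perm (Fin k), if i = j ∘ σ then c (j ∘ σ) else 0)
      (∑ σ : Equiv.Perm (Fin k), c (j ∘ σ)) :=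
    hasSum_sum fun σ _ => hasSum_ite_eq (j ∘ σ) (c (j ∘ σ))
  have h3 : (fun i => inner ℝ (w j) (c i • w i)) =
      fun i => ∑ σ : Equiv.Perm (Fin k), if i = j ∘ σ then c (j ∘ σ) else 0 := by
    funext i
    rw [real_inner_smul_right, hw.inner_eq, Finset.mul_sum]
    refine Finset.sum_congr rfl fun σ _ => ?_
    by_cases h : j ∘ σ = i
    · subst h; simp
    · rw [if_neg h, if_neg (Ne.symm h), mul_zero]
  rw [h3] at h1
  rw [real_inner_comm, h1.unique h2]
  simp_rw [hc]
  simp [Fintype.card_perm]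

/-- The coefficients `⟨x, w i⟩ / k!`. -/
theorem hasSum_of_mem [CompleteSpace E] (hw : IsFockFamily w) {x : E}
    (hx : x ∈ (Submodule.span ℝ (Set.range w)).topologicalClosure) :
    HasSum (fun i => ((k.factorial : ℝ)⁻¹ * inner ℝ x (w i)) • w i) x := by
  have hk : (k.factorial : ℝ) ≠ 0 := by positivity
  have hs : Summable fun i => ((k.factorial : ℝ)⁻¹ * inner ℝ x (w i)) • w i := by
    refine hw.summable ?_
    simp_rw [mul_pow]
    exact (hw.summable_inner_sq x).mul_left _
  obtain ⟨y, hy⟩ := hs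
  have hyV : y ∈ (Submodule.span ℝ (Set.range w)).topologicalClosure := by
    refine IsClosed.mem_of_tendsto (Submodule.isClosed_topologicalClosure _) hy
      (Eventually.of_forall fun s => ?_)
    refine Submodule.sum_mem _ fun i _ => Submodule.smul_mem _ _ ?_
    exact Submodule.le_topologicalClosure _ (Submodule.subset_span ⟨i, rfl⟩)
  -- The residual lies in the closed span and is orthogonal to its generators, hence vanishes.
  have h1 : ∀ j, inner ℝ (x - y) (w j) = 0 := by
    intro j
    rw [inner_sub_left, hw.inner_of_hasSum (fun i σ => by rw [hw.comp_perm]) hy j]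
    field_simp
    ring
  have h2 : x - y ∈ (Submodule.span ℝ (Set.range w)).topologicalClosureᗮ := by
    rw [Submodule.orthogonal_closure]
    rw [Submodule.mem_orthogonal']
    intro u hu
    induction hu using Submodule.span_induction with
    | mem u hu => obtain ⟨j, rfl⟩ := hu; exact h1 j
    | zero => simp
    | add u v _ _ hu hv => rw [inner_add_right, hu, hv, add_zero]
    | smul a u _ hu => rw [real_inner_smul_right, hu, mul_zero]
  have h3 : x - y = 0 := by
    have := Submodule.inner_right_of_mem_orthogonal (Submodule.sub_mem _ hx hyV) h2
    exact inner_self_eq_zero.1 this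
  rwa [← sub_eq_zero.1 h3] at hy

end IsFockFamily

/-- A vector in the closed span of the mutually orthogonal spaces spanned by the `w k` is the sum
of its components. -/
theorem exists_hasSum_of_mem_closure_iSup [CompleteSpace E] {V : ℕ → Submodule ℝ E}
    (hcl : ∀ k, IsClosed (V k : Set E))
    (hV : ∀ k l, k ≠ l → ∀ x ∈ V k, ∀ y ∈ V l, inner ℝ x y = 0) {x : E}
    (hx : x ∈ (⨆ k, V k).topologicalClosure) :
    ∃ a : ℕ → E, (∀ k, a k ∈ V k) ∧ HasSum a x := by
  have hc : ∀ k, CompleteSpace (V k) := fun k => (hcl k).completeSpace_coe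
  have ho : OrthogonalFamily ℝ (fun k => V k) fun k => (V k).subtypeₗᵢ := by
    intro k l hkl u v
    exact hV k l hkl u u.2 v v.2
  have hr := ho.range_linearIsometry
  simp only [Submodule.subtypeₗᵢ_toLinearMap, Submodule.range_subtype] at hr
  rw [← hr] at hx
  obtain ⟨f, rfl⟩ := hx
  exact ⟨fun k => f k, fun k => (f k).2, ho.hasSum_linearIsometry f⟩

end FockFamily

/-! ### Square-mean sums as sums in `L²` -/

section SquareMean

variable {Ω : Type*} [MeasurableSpace Ω] {P : Measure Ω} {κ : Type*}

theorem inner_toLp {f g : Ω → ℝ} (hf : MemLp f 2 P) (hg : MemLp g 2 P) :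
    inner ℝ (hf.toLp f) (hg.toLp g) = ∫ ω, f ω * g ω ∂P := by
  rw [L2.inner_def]
  refine integral_congr_ae ?_
  filter_upwards [hf.coeFn_toLp, hg.coeFn_toLp] with ω h1 h2
  simp [h1, h2, mul_comm]

theorem integrable_mul_of_memLp_two {f g : Ω → ℝ} (hf : MemLp f 2 P) (hg : MemLp g 2 P) :
    Integrable (fun ω => f ω * g ω) P :=
  hf.integrable_mul hg

theorem inner_eq_integral (f g : Lp ℝ 2 P) : inner ℝ f g = ∫ ω, f ω * g ω ∂P := by
  rw [L2.inner_def]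
  refine integral_congr_ae (ae_of_all _ fun ω => ?_)
  simp [mul_comm]

theorem sum_toLp {g : κ → Ω → ℝ} (hg : ∀ i, MemLp (g i) 2 P) (s : Finset κ) :
    ∑ i ∈ s, (hg i).toLp (g i) =
      (memLp_finsetSum s fun i _ => hg i).toLp (fun ω => ∑ i ∈ s, g i ω) := by
  refine Lp.ext ?_
  have h1 := Lp.coeFn_finsetSum s fun i => (hg i).toLp (g i)
  have h2 : ∀ᵐ ω ∂P, ∀ i ∈ s, (hg i).toLp (g i) ω = g i ω := by
    exact (Finset.eventually_all s).2 fun i _ => (hg i).coeFn_toLp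
  filter_upwards [h1, h2, (memLp_finsetSum s fun i _ => hg i).coeFn_toLp] with ω h1 h2 h3
  rw [h1, h3]
  simp only [Finset.sum_apply]
  exact Finset.sum_congr rfl h2

theorem hasSumL2_iff {g : κ → Ω → ℝ} (hg : ∀ i, MemLp (g i) 2 P) {β : Ω → ℝ}
    (hβ : MemLp β 2 P) :
    HasSumL2 P g β ↔ HasSum (fun i => (hg i).toLp (g i)) (hβ.toLp β) := by
  unfold HasSumL2 HasSum
  simp_rw [sum_toLp hg]
  rw [Lp.tendsto_Lp_iff_tendsto_eLpNorm'']
  exact and_iff_right hβ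

theorem HasSumL2.hasSum_integral_mul {g : κ → Ω → ℝ} (hg : ∀ i, MemLp (g i) 2 P) {β f : Ω → ℝ}
    (h : HasSumL2 P g β) (hf : MemLp f 2 P) :
    HasSum (fun i => ∫ ω, f ω * g i ω ∂P) (∫ ω, f ω * β ω ∂P) := by
  have h1 := ((hasSumL2_iff hg h.1).1 h).mapL (innerSL ℝ (hf.toLp f))
  simpa only [innerSL_apply_apply, inner_toLp] using h1

end SquareMean

/-- The classes having an `m`-measurable version form a closed subset of `L²`. -/
theorem HasSumL2.aestronglyMeasurable {Ω κ : Type*} {m m0 : MeasurableSpace Ω} {P : Measure Ω}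
    (hm : m ≤ m0)
    {g : κ → Ω → ℝ} (hg : ∀ i, MemLp (g i) 2 P) (hgm : ∀ i, AEStronglyMeasurable[m] (g i) P)
    {β : Ω → ℝ} (h : HasSumL2 P g β) : AEStronglyMeasurable[m] β P := by
  have h1 := (hasSumL2_iff hg h.1).1 h
  have h2 : h.1.toLp β ∈ {f : Lp ℝ 2 P | AEStronglyMeasurable[m] f P} := by
    refine (isClosed_aestronglyMeasurable hm).mem_of_tendsto h1 (Eventually.of_forall fun s => ?_)
    change AEStronglyMeasurable[m] _ P
    rw [sum_toLp hg]
    refine AEStronglyMeasurable.congr ?_ (MemLp.coeFn_toLp _).symm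
    refine ⟨fun ω => ∑ i ∈ s, (hgm i).mk (g i) ω,
      Finset.stronglyMeasurable_fun_sum s fun i _ => (hgm i).stronglyMeasurable_mk, ?_⟩
    filter_upwards [(Finset.eventually_all s).2 fun i _ => (hgm i).ae_eq_mk] with ω hω
    exact Finset.sum_congr rfl hω
  exact AEStronglyMeasurable.congr h2 h.1.coeFn_toLp

theorem sigmaOf_eq_comap {Ω H : Type*} (ξ : H → Ω → ℝ) :
    sigmaOf ξ = MeasurableSpace.comap (fun ω φ => ξ φ ω) MeasurableSpace.pi := by
  simp only [MeasurableSpace.pi, MeasurableSpace.comap_iSup, MeasurableSpace.comap_comp]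
  rfl

/-! ### Totality of the exponentials and Wick expansions -/

namespace IsGenGaussian

variable {Ω : Type*} [MeasurableSpace Ω] {P : Measure Ω} [IsProbabilityMeasure P]
  {H : Type*} [NormedAddCommGroup H] [InnerProductSpace ℝ H] {ξ : H → Ω → ℝ}

theorem measurable_field (hξ : IsGenGaussian P ξ) : Measurable fun ω φ => ξ φ ω :=
  measurable_pi_lambda _ hξ.measurable

/-- The exponentials `exp ((φ, ξ) - ‖φ‖² / 2)` are total in `L²(σ(ξ))`. -/
theorem ae_eq_zero_of_integral_expVec_mul (hξ : IsGenGaussian P ξ) {β : Ω → ℝ}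
    (hβ : MemLp β 2 P) (hm : AEStronglyMeasurable[sigmaOf ξ] β P)
    (h : ∀ φ, ∫ ω, expVec ξ φ ω * β ω ∂P = 0) : β =ᵐ[P] 0 := by
  obtain ⟨β', hβ'm, hββ'⟩ := hm
  have hβ' : MemLp β' 2 P := hβ.ae_eq hββ'
  have hmeas : Measurable[sigmaOf ξ] β' := hβ'm.measurable
  have hmeas0 : Measurable β' := hmeas.mono hξ.sigmaOf_le le_rfl
  rw [sigmaOf_eq_comap] at hmeas
  obtain ⟨b, hb, hbβ⟩ := hmeas.exists_eq_measurable_comp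
  have hbβ' : ∀ ω, β' ω = b fun φ => ξ φ ω := fun ω => congrFun hbβ ω
  let D₁ : Ω → ℝ := fun ω => max (β' ω) 0
  let D₂ : Ω → ℝ := fun ω => max (-β' ω) 0
  have m₁ : Measurable D₁ := hmeas0.max measurable_const
  have m₂ : Measurable D₂ := hmeas0.neg.max measurable_const
  have l₁ : MemLp D₁ 2 P := hβ'.pos_part
  have l₂ : MemLp D₂ 2 P := hβ'.neg_part
  have n₁ : ∀ ω, 0 ≤ D₁ ω := fun ω => le_max_right _ _
  have n₂ : ∀ ω, 0 ≤ D₂ ω := fun ω => le_max_right _ _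
  have hD : ∀ ω, D₁ ω - D₂ ω = β' ω := fun ω => by
    rcases le_total 0 (β' ω) with h0 | h0
    · simp [D₁, D₂, h0]
    · simp [D₁, D₂, h0]
  have := isFiniteMeasure_withDensity_of_memLp l₁
  have := isFiniteMeasure_withDensity_of_memLp l₂
  -- The hypothesis says that the densities `D₁`, `D₂`, the positive and negative parts of `β'`,
  -- give `ξ` the same exponential moments.
  have hlaw : (P.withDensity fun ω => ENNReal.ofReal (D₁ ω)).map (fun ω φ => ξ φ ω) =
      (P.withDensity fun ω => ENNReal.ofReal (D₂ ω)).map (fun ω φ => ξ φ ω) := by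
    refine (hξ.isExpField.withDensity l₁ m₁ n₁).map_eq (hξ.isExpField.withDensity l₂ m₂ n₂) ?_
    intro φ
    rw [integral_withDensity_ofReal m₁ n₁, integral_withDensity_ofReal m₂ n₂, ← sub_eq_zero,
      ← integral_sub]
    · have h0 := h φ
      have e : (fun ω => D₁ ω * Real.exp (ξ φ ω) - D₂ ω * Real.exp (ξ φ ω)) =ᵐ[P]
          fun ω => Real.exp (‖φ‖ ^ 2 / 2) * (expVec ξ φ ω * β ω) := by
        filter_upwards [hββ'] with ω hω
        rw [← sub_mul, hD, hω, expVec, Real.exp_sub]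
        field_simp
      rw [integral_congr_ae e, integral_const_mul, h0, mul_zero]
    · exact l₁.integrable_mul (hξ.isExpField.memLp_exp φ)
    · exact l₂.integrable_mul (hξ.isExpField.memLp_exp φ)
  -- Test the equality of laws on `β'` itself, a function of the path; the difference of the sides
  -- is `∫ β'²`.
  have key : ∫ ω, D₁ ω * β' ω ∂P = ∫ ω, D₂ ω * β' ω ∂P := by
    rw [← integral_withDensity_ofReal m₁ n₁, ← integral_withDensity_ofReal m₂ n₂]
    simp_rw [hbβ']
    rw [← integral_map (f := b) hξ.measurable_field.aemeasurable hb.aestronglyMeasurable, hlaw,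
      integral_map hξ.measurable_field.aemeasurable hb.aestronglyMeasurable]
  have hsq : ∫ ω, β' ω ^ 2 ∂P = 0 := by
    have e : ∀ ω, β' ω ^ 2 = D₁ ω * β' ω - D₂ ω * β' ω := fun ω => by
      rw [← sub_mul, hD, sq]
    simp_rw [e]
    rw [integral_sub (integrable_mul_of_memLp_two l₁ hβ')
      (integrable_mul_of_memLp_two l₂ hβ'), key, sub_self]
  rw [integral_eq_zero_iff_of_nonneg (fun ω => sq_nonneg _) hβ'.integrable_sq] at hsq
  filter_upwards [hsq, hββ'] with ω h1 h2
  rw [h2]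
  simpa using h1

variable {ι : Type*} {k : ℕ}

/-- The Hermite products as elements of `L²`. -/
noncomputable def wickLp (hξ : IsGenGaussian P ξ) (e : HilbertBasis ι ℝ H) (i : Fin k → ι) :
    Lp ℝ 2 P :=
  (hξ.memLp_wickProduct e i).toLp _

theorem isFockFamily_wickLp (hξ : IsGenGaussian P ξ) (e : HilbertBasis ι ℝ H) (k : ℕ) :
    IsFockFamily (fun i : Fin k → ι => hξ.wickLp e i) where
  comp_perm i σ := by
    refine Lp.ext ?_
    filter_upwards [(hξ.memLp_wickProduct e i).coeFn_toLp,
      (hξ.memLp_wickProduct e (i ∘ σ)).coeFn_toLp] with ω h1 h2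
    simp only [wickLp]
    rw [h1, h2, wickProduct_comp_perm]
  inner_eq i j := by
    classical
    simp only [wickLp]
    rw [inner_toLp, hξ.integral_wickProduct_mul, Fintype.card_subtype, Finset.card_filter]
    push_cast
    refine Finset.sum_congr rfl fun σ _ => ?_
    congr

theorem memLp_coeff_mul_wickProduct (hξ : IsGenGaussian P ξ) (e : HilbertBasis ι ℝ H) (c : ℝ)
    (i : Fin k → ι) : MemLp (fun ω => c * wickProduct ξ e i ω) 2 P :=
  (hξ.memLp_wickProduct e i).const_mul c

theorem hasSumL2_wickProduct_iff (hξ : IsGenGaussian P ξ) (e : HilbertBasis ι ℝ H)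
    (c : (Fin k → ι) → ℝ) {β : Ω → ℝ} (hβ : MemLp β 2 P) :
    HasSumL2 P (fun i ω => c i * wickProduct ξ e i ω) β ↔
      HasSum (fun i => c i • hξ.wickLp e i) (hβ.toLp β) := by
  rw [hasSumL2_iff (fun i => hξ.memLp_coeff_mul_wickProduct e (c i) i) hβ]
  rfl

theorem hasSum_integral_expVec_mul (hξ : IsGenGaussian P ξ) (e : HilbertBasis ι ℝ H)
    (c : (Fin k → ι) → ℝ) {β : Ω → ℝ} (h : HasSumL2 P (fun i ω => c i * wickProduct ξ e i ω) β)
    (φ : H) :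
    HasSum (fun i => c i * ∏ j, inner ℝ (e (i j)) φ) (∫ ω, expVec ξ φ ω * β ω ∂P) := by
  have h1 := h.hasSum_integral_mul (fun i => hξ.memLp_coeff_mul_wickProduct e (c i) i)
    (hξ.memLp_expVec φ)
  refine h1.congr_fun ?_ |> fun h => h
  intro i
  rw [← hξ.integral_expVec_mul_wickProduct e φ i, ← integral_const_mul]
  congr 1; ext ω; ring

theorem aestronglyMeasurable_of_hasSumL2 (hξ : IsGenGaussian P ξ) (e : HilbertBasis ι ℝ H)
    (c : (Fin k → ι) → ℝ) {β : Ω → ℝ}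
    (h : HasSumL2 P (fun i ω => c i * wickProduct ξ e i ω) β) :
    AEStronglyMeasurable[sigmaOf ξ] β P :=
  h.aestronglyMeasurable hξ.sigmaOf_le (fun i => hξ.memLp_coeff_mul_wickProduct e (c i) i)
    fun i => (((measurable_wickProduct ξ e i).const_mul (c i)).stronglyMeasurable).aestronglyMeasurable

end IsGenGaussian

/-! ### Basis expansions of multilinear forms -/

section MultilinearExpansion

variable {H : Type*} [NormedAddCommGroup H] [InnerProductSpace ℝ H] {ι : Type*} {k : ℕ}

theorem tendsto_piFinset_atTop (k : ℕ) (ι : Type*) :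
    Tendsto (fun s : Finset ι => Fintype.piFinset fun _ : Fin k => s) atTop atTop := by
  refine tendsto_atTop_finset_of_monotone ?_ ?_
  · intro s t hst
    exact Fintype.piFinset_subset _ _ fun _ => hst
  · intro i
    classical
    exact ⟨Finset.univ.image i, Fintype.mem_piFinset.2 fun j =>
      Finset.mem_image_of_mem _ (Finset.mem_univ _)⟩

/-- The only possible value of the expansion of a form in an orthonormal basis. -/
theorem ContinuousMultilinearMap.eq_of_hasSum_basis
    (A : ContinuousMultilinearMap ℝ (fun _ : Fin k => H) ℝ) (e : HilbertBasis ι ℝ H)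
    (v : Fin k → H) {y : ℝ}
    (h : HasSum (fun i : Fin k → ι => A (fun j => e (i j)) * ∏ j, inner ℝ (e (i j)) (v j)) y) :
    y = A v := by
  -- Along boxes `s^k` the sum is, by multilinearity, `A` at the partial expansions of the `v j`;
  -- continuity of `A` gives the limit.
  have h1 := h.comp (tendsto_piFinset_atTop k ι)
  have h2 : Tendsto (fun s : Finset ι => A fun j => ∑ l ∈ s, inner ℝ (e l) (v j) • e l) atTop
      (𝓝 (A v)) := by
    refine (A.cont.tendsto _).comp (tendsto_pi_nhds.2 fun j => ?_)
    have := e.hasSum_repr (v j)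
    simp_rw [e.repr_apply_apply] at this
    exact this
  refine tendsto_nhds_unique (h1.congr fun s => ?_) h2
  classical
  rw [A.map_sum_finset (fun j l => inner ℝ (e l) (v j) • e l) fun _ => s]
  simp only [Function.comp_apply]
  refine Finset.sum_congr rfl fun i _ => ?_
  rw [A.map_smul_univ (fun j => inner ℝ (e (i j)) (v j)) fun j => e (i j), smul_eq_mul, mul_comm]

end MultilinearExpansion

/-- Distinct orthonormal vectors lie at distance `√2`, so separability makes a basis countable.
Reindexing by a subset of `ℕ` puts the index type in `Type`, as `IsHermiteValue` demands. -/
theorem exists_countable_hilbertBasis (H : Type*) [NormedAddCommGroup H] [InnerProductSpace ℝ H]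
    [CompleteSpace H] [TopologicalSpace.SeparableSpace H] :
    ∃ ι : Type, Nonempty (HilbertBasis ι ℝ H) := by
  obtain ⟨w, b, hb⟩ := exists_hilbertBasis ℝ H
  have hw : Countable w := by
    have : DiscreteTopology w := by
      refine DiscreteTopology.of_forall_le_dist zero_lt_one fun x y hxy => ?_
      have ho := b.orthonormal
      have h1 : ‖b x - b y‖ ^ 2 = 2 := by
        rw [norm_sub_sq_real, ho.1, ho.1, ho.2 hxy]; norm_num
      have h2 : dist x y = ‖b x - b y‖ := by
        rw [hb, Subtype.dist_eq, dist_eq_norm]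
      change 1 ≤ dist x y
      rw [h2]
      nlinarith [norm_nonneg (b x - b y)]
    have : SecondCountableTopology H := UniformSpace.secondCountable_of_separable H
    exact countable_of_Lindelof_of_discrete
  obtain ⟨f, hf⟩ := hw.exists_injective_nat
  let g := Equiv.ofInjective f hf
  refine ⟨Set.range f, ⟨HilbertBasis.mk (v := b ∘ g.symm)
    (b.orthonormal.comp _ g.symm.injective) ?_⟩⟩
  rw [g.symm.surjective.range_comp, b.dense_span]

/-! ### Hermite polynomials characterized by pairings with exponentials -/

section HermiteValue

variable {Ω : Type*} [MeasurableSpace Ω] {P : Measure Ω} [IsProbabilityMeasure P]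
  {H : Type*} [NormedAddCommGroup H] [InnerProductSpace ℝ H] {ξ : H → Ω → ℝ} {k : ℕ}
  {A : ContinuousMultilinearMap ℝ (fun _ : Fin k => H) ℝ} {β : Ω → ℝ}

theorem IsHermiteValue.integral_expVec_mul (h : IsHermiteValue P ξ A β) (hξ : IsGenGaussian P ξ)
    {ι : Type} (e : HilbertBasis ι ℝ H) (φ : H) :
    ∫ ω, expVec ξ φ ω * β ω ∂P = A fun _ => φ :=
  A.eq_of_hasSum_basis e (fun _ => φ) (hξ.hasSum_integral_expVec_mul e _ (h e) φ)

theorem IsHermiteValue.aestronglyMeasurable (h : IsHermiteValue P ξ A β) (hξ : IsGenGaussian P ξ)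
    {ι : Type} (e : HilbertBasis ι ℝ H) : AEStronglyMeasurable[sigmaOf ξ] β P :=
  hξ.aestronglyMeasurable_of_hasSumL2 e _ (h e)

/-- A square integrable functional of `ξ` is `A(ξ, …, ξ)` if its integrals against the exponentials
are the values of `A` on the diagonal. -/
theorem IsGenGaussian.isHermiteValue_of_integral (hξ : IsGenGaussian P ξ)
    (hA : IsSymmHilbertSchmidt A) (hβ : MemLp β 2 P) (hm : AEStronglyMeasurable[sigmaOf ξ] β P)
    (h : ∀ φ, ∫ ω, expVec ξ φ ω * β ω ∂P = A fun _ => φ) : IsHermiteValue P ξ A β := by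
  intro ι e
  obtain ⟨y, hy⟩ := (hξ.isFockFamily_wickLp e k).summable (hA.summable e)
  have hy' : HasSumL2 P (fun i ω => A (fun j => e (i j)) * wickProduct ξ e i ω) y := by
    rw [hξ.hasSumL2_wickProduct_iff e _ (Lp.memLp y), Lp.toLp_coeFn]
    exact hy
  -- The pairings of `β` and of the expansion `y` are the diagonal values of `A`, which do not
  -- involve the basis; totality identifies the two.
  have hz : (fun ω => β ω - y ω) =ᵐ[P] 0 := by
    refine hξ.ae_eq_zero_of_integral_expVec_mul (hβ.sub (Lp.memLp y))
      (hm.sub (hξ.aestronglyMeasurable_of_hasSumL2 e _ hy')) fun φ => ?_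
    simp_rw [mul_sub]
    rw [integral_sub (integrable_mul_of_memLp_two (hξ.memLp_expVec φ) hβ)
      (integrable_mul_of_memLp_two (hξ.memLp_expVec φ) (Lp.memLp y)), h,
      A.eq_of_hasSum_basis e (fun _ => φ) (hξ.hasSum_integral_expVec_mul e _ hy' φ), sub_self]
  rw [hξ.hasSumL2_wickProduct_iff e _ hβ]
  have : hβ.toLp β = y := by
    refine Lp.ext ?_
    filter_upwards [hβ.coeFn_toLp, hz] with ω h1 h2
    rw [h1]
    exact sub_eq_zero.1 h2
  rwa [this]

end HermiteValue

/-! ### Hilbert-Schmidt forms: contractions, change of basis, coefficients -/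

section HilbertSchmidt

variable {H : Type*} [NormedAddCommGroup H] [InnerProductSpace ℝ H]

/-- Parseval for the Riesz representative. -/
theorem tsum_ofReal_apply_basis_sq [CompleteSpace H] {ι : Type*} (e : HilbertBasis ι ℝ H)
    (a : H →L[ℝ] ℝ) :
    ∑' l, ENNReal.ofReal (a (e l) ^ 2) = ENNReal.ofReal (‖a‖ ^ 2) := by
  obtain ⟨x, rfl⟩ := (InnerProductSpace.toDual ℝ H).surjective a
  have h := e.hasSum_inner_mul_inner x x
  simp only [InnerProductSpace.toDual_apply_apply, LinearIsometryEquiv.norm_map]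
  rw [← real_inner_self_eq_norm_sq, ← h.tsum_eq]
  have e1 : ∀ l, inner ℝ x (e l) * inner ℝ (e l) x = inner ℝ x (e l) ^ 2 := fun l => by
    rw [real_inner_comm (e l) x, sq]
  simp_rw [e1] at h ⊢
  exact (ENNReal.ofReal_tsum_of_nonneg (fun l => sq_nonneg _) h.summable).symm

theorem tsum_fin_succ_arrow {ι : Type*} {k : ℕ} (f : (Fin (k + 1) → ι) → ENNReal) :
    ∑' i, f i = ∑' l, ∑' i : Fin k → ι, f (Fin.cons l i) := by
  rw [← (Fin.consEquiv fun _ : Fin (k + 1) => ι).tsum_eq, ENNReal.tsum_prod']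
  rfl

theorem comp_fin_cons {κ M : Type*} {k : ℕ} (f : κ → M) (l : κ) (i : Fin k → κ) :
    (fun j => f ((Fin.cons l i : Fin (k + 1) → κ) j)) =
      (Fin.cons (f l) fun j => f (i j) : Fin (k + 1) → M) := by
  funext j
  refine Fin.cases ?_ (fun j => ?_) j <;> simp

/-- The Hilbert-Schmidt norm of a form does not increase under a substitution by a contraction. In
particular it does not depend on the basis. -/
theorem tsum_ofReal_comp_sq_le [CompleteSpace H] {ι ι' : Type*} (e : HilbertBasis ι ℝ H)
    (e' : HilbertBasis ι' ℝ H) (C : H →L[ℝ] H) (hC : ‖C‖ ≤ 1) {k : ℕ}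
    (A : ContinuousMultilinearMap ℝ (fun _ : Fin k => H) ℝ) :
    ∑' i : Fin k → ι', ENNReal.ofReal (A (fun j => C (e' (i j))) ^ 2) ≤
      ∑' i : Fin k → ι, ENNReal.ofReal (A (fun j => e (i j)) ^ 2) := by
  induction k with
  | zero =>
    rw [tsum_fintype, tsum_fintype]
    simp only [Finset.univ_unique, Finset.sum_singleton]
    rw [Subsingleton.elim (fun j => C (e' ((default : Fin 0 → ι') j)))
      fun j => e ((default : Fin 0 → ι) j)]
  | succ k ih =>
    let a : (Fin k → ι) → H →L[ℝ] ℝ := fun i =>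
      (ContinuousMultilinearMap.apply ℝ (fun _ : Fin k => H) ℝ fun j => e (i j)).comp A.curryLeft
    have ha : ∀ i x, a i x = A (Fin.cons x fun j => e (i j)) := fun i x => rfl
    rw [tsum_fin_succ_arrow, tsum_fin_succ_arrow]
    -- Induction treats the last `k` arguments. Exchanging the sums, free in `ENNReal`, leaves a
    -- functional of the first argument, where Parseval reduces the claim to `‖a ∘ C‖ ≤ ‖a‖`.
    calc _ = ∑' l, ∑' i : Fin k → ι', ENNReal.ofReal
            (A.curryLeft (C (e' l)) (fun j => C (e' (i j))) ^ 2) := by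
          refine tsum_congr fun l => tsum_congr fun i => ?_
          rw [comp_fin_cons (fun x => C (e' x))]
          rfl
      _ ≤ ∑' l, ∑' i : Fin k → ι, ENNReal.ofReal
            (A.curryLeft (C (e' l)) (fun j => e (i j)) ^ 2) :=
          ENNReal.tsum_le_tsum fun l => ih _
      _ = ∑' i : Fin k → ι, ∑' l, ENNReal.ofReal (((a i).comp C) (e' l) ^ 2) := by
          rw [ENNReal.tsum_comm]; rfl
      _ ≤ ∑' i : Fin k → ι, ∑' l, ENNReal.ofReal (a i (e l) ^ 2) := by
          refine ENNReal.tsum_le_tsum fun i => ?_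
          rw [tsum_ofReal_apply_basis_sq, tsum_ofReal_apply_basis_sq]
          gcongr
          refine ((a i).opNorm_comp_le C).trans ?_
          exact mul_le_of_le_one_right (norm_nonneg _) hC
      _ = _ := by
          rw [ENNReal.tsum_comm]
          refine tsum_congr fun l => tsum_congr fun i => ?_
          rw [comp_fin_cons (fun x => e x), ha]

theorem summable_iff_tsum_ofReal_ne_top {κ : Type*} {f : κ → ℝ} (hf : ∀ i, 0 ≤ f i) :
    Summable f ↔ ∑' i, ENNReal.ofReal (f i) ≠ ⊤ := by
  constructor
  · exact fun h => h.tsum_ofReal_ne_top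
  · intro h
    have := ENNReal.summable_toReal h
    simpa only [ENNReal.toReal_ofReal (hf _)] using this

theorem IsSymmHilbertSchmidt.comp [CompleteSpace H] [TopologicalSpace.SeparableSpace H] {k : ℕ}
    {A : ContinuousMultilinearMap ℝ (fun _ : Fin k => H) ℝ} (hA : IsSymmHilbertSchmidt A)
    (C : H →L[ℝ] H) (hC : ‖C‖ ≤ 1) :
    IsSymmHilbertSchmidt (A.compContinuousLinearMap fun _ => C) where
  symm σ v := hA.symm σ fun j => C (v j)
  summable {ι} e := by
    have h := (summable_iff_tsum_ofReal_ne_top fun i => sq_nonneg _).1 (hA.summable e)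
    rw [summable_iff_tsum_ofReal_ne_top fun i => sq_nonneg _]
    exact ne_top_of_le_ne_top h (tsum_ofReal_comp_sq_le e e C hC A)

/-- The form `v ↦ ∏ ⟨e_{i j}, v j⟩`. -/
noncomputable def coordForm {ι : Type*} {k : ℕ} (e : HilbertBasis ι ℝ H) (i : Fin k → ι) :
    MultilinearMap ℝ (fun _ : Fin k => H) ℝ :=
  (MultilinearMap.mkPiAlgebra ℝ (Fin k) ℝ).compLinearMap fun j =>
    (innerSL ℝ (e (i j))).toLinearMap

theorem coordForm_apply {ι : Type*} {k : ℕ} (e : HilbertBasis ι ℝ H) (i : Fin k → ι)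
    (v : Fin k → H) : coordForm e i v = ∏ j, inner ℝ (e (i j)) (v j) := by
  simp [coordForm]

/-- Enlarging `s` to a box makes the sum factor over the arguments, and Bessel applies to each
factor. -/
theorem sum_coordForm_sq_le [CompleteSpace H] {ι : Type*} {k : ℕ} (e : HilbertBasis ι ℝ H)
    (v : Fin k → H) (s : Finset (Fin k → ι)) :
    ∑ i ∈ s, coordForm e i v ^ 2 ≤ (∏ j, ‖v j‖) ^ 2 := by
  classical
  let t : Finset ι := s.biUnion fun i => Finset.univ.image i
  have hst : s ⊆ Fintype.piFinset fun _ => t := fun i hi => Fintype.mem_piFinset.2 fun j =>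
    Finset.mem_biUnion.2 ⟨i, hi, Finset.mem_image_of_mem _ (Finset.mem_univ _)⟩
  calc ∑ i ∈ s, coordForm e i v ^ 2
      ≤ ∑ i ∈ Fintype.piFinset fun _ => t, coordForm e i v ^ 2 :=
        Finset.sum_le_sum_of_subset_of_nonneg hst fun _ _ _ => sq_nonneg _
    _ = ∏ j, ∑ l ∈ t, inner ℝ (e l) (v j) ^ 2 := by
        rw [Finset.prod_univ_sum]
        refine Finset.sum_congr rfl fun i _ => ?_
        rw [coordForm_apply, Finset.prod_pow]
    _ ≤ ∏ j, ‖v j‖ ^ 2 := by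
        refine Finset.prod_le_prod (fun j _ => Finset.sum_nonneg fun _ _ => sq_nonneg _)
          fun j _ => ?_
        simpa using e.orthonormal.sum_inner_products_le (v j) (s := t)
    _ = _ := Finset.prod_pow _ _ _

theorem abs_sum_mul_coordForm_le [CompleteSpace H] {ι : Type*} {k : ℕ} (e : HilbertBasis ι ℝ H)
    {c : (Fin k → ι) → ℝ} (hc : Summable fun i => c i ^ 2) (v : Fin k → H)
    (s : Finset (Fin k → ι)) :
    |∑ i ∈ s, c i * coordForm e i v| ≤ √(∑' i, c i ^ 2) * ∏ j, ‖v j‖ := by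
  have h0 : 0 ≤ ∏ j, ‖v j‖ := Finset.prod_nonneg fun _ _ => norm_nonneg _
  rw [← Real.sqrt_sq h0, ← Real.sqrt_mul (tsum_nonneg fun _ => sq_nonneg _)]
  refine Real.abs_le_sqrt ((Finset.sum_mul_sq_le_sq_mul_sq s _ _).trans ?_)
  gcongr
  · exact hc.sum_le_tsum s fun _ _ => sq_nonneg _
  · exact sum_coordForm_sq_le e v s

theorem summable_mul_coordForm [CompleteSpace H] {ι : Type*} {k : ℕ} (e : HilbertBasis ι ℝ H)
    {c : (Fin k → ι) → ℝ} (hc : Summable fun i => c i ^ 2) (v : Fin k → H) :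
    Summable fun i => c i * coordForm e i v := by
  have h2 : Summable fun i => coordForm e i v ^ 2 :=
    summable_of_sum_le (fun _ => sq_nonneg _) (sum_coordForm_sq_le e v)
  refine Summable.of_norm_bounded (hc.add h2) fun i => ?_
  rw [Real.norm_eq_abs, abs_le]
  constructor <;> nlinarith [sq_nonneg (c i + coordForm e i v), sq_nonneg (c i - coordForm e i v),
    sq_nonneg (c i), sq_nonneg (coordForm e i v)]

/-- The form with square summable coefficients `c` in the basis `e`. -/
noncomputable def formOfCoeff [CompleteSpace H] {ι : Type*} {k : ℕ} (e : HilbertBasis ι ℝ H)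
    (c : (Fin k → ι) → ℝ) (hc : Summable fun i => c i ^ 2) :
    ContinuousMultilinearMap ℝ (fun _ : Fin k => H) ℝ :=
  MultilinearMap.mkContinuous
    { toFun := fun v => ∑' i, c i * coordForm e i v
      map_update_add' := fun v j x y => by
        simp_rw [(coordForm e _).map_update_add, mul_add]
        exact (summable_mul_coordForm e hc _).tsum_add (summable_mul_coordForm e hc _)
      map_update_smul' := fun v j a x => by
        simp_rw [(coordForm e _).map_update_smul, smul_eq_mul, mul_left_comm _ a]
        exact tsum_mul_left }
    (√(∑' i, c i ^ 2)) fun v => by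
      have := (summable_mul_coordForm e hc v).hasSum
      exact le_of_tendsto this.norm (Eventually.of_forall (abs_sum_mul_coordForm_le e hc v))

theorem formOfCoeff_apply [CompleteSpace H] {ι : Type*} {k : ℕ} (e : HilbertBasis ι ℝ H)
    (c : (Fin k → ι) → ℝ) (hc : Summable fun i => c i ^ 2) (v : Fin k → H) :
    formOfCoeff e c hc v = ∑' i, c i * ∏ j, inner ℝ (e (i j)) (v j) := by
  simp_rw [← coordForm_apply]; rfl

theorem formOfCoeff_basis [CompleteSpace H] {ι : Type*} {k : ℕ} (e : HilbertBasis ι ℝ H)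
    (c : (Fin k → ι) → ℝ) (hc : Summable fun i => c i ^ 2) (i : Fin k → ι) :
    formOfCoeff e c hc (fun j => e (i j)) = c i := by
  rw [formOfCoeff_apply, tsum_eq_single i]
  · simp [e.orthonormal.1]
  · intro i' hi'
    obtain ⟨j, hj⟩ := Function.ne_iff.1 hi'
    rw [Finset.prod_eq_zero (Finset.mem_univ j) (e.orthonormal.2 hj), mul_zero]

theorem isSymmHilbertSchmidt_formOfCoeff [CompleteSpace H]
    {ι : Type*} {k : ℕ} (e : HilbertBasis ι ℝ H) (c : (Fin k → ι) → ℝ)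
    (hc : Summable fun i => c i ^ 2) (hsymm : ∀ i (σ : Equiv.Perm (Fin k)), c (i ∘ σ) = c i) :
    IsSymmHilbertSchmidt (formOfCoeff e c hc) where
  symm σ v := by
    rw [formOfCoeff_apply, formOfCoeff_apply, ← (σ.arrowCongr (Equiv.refl ι)).symm.tsum_eq]
    refine tsum_congr fun i => ?_
    have h1 : (σ.arrowCongr (Equiv.refl ι)).symm i = i ∘ σ := rfl
    rw [h1, hsymm]
    congr 1
    exact Equiv.prod_comp σ fun j => inner ℝ (e (i j)) (v j)
  summable {κ} e' := by
    -- Summability in the basis `e` is the hypothesis on `c`; the contraction bound with the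
    -- identity operator carries it to `e'`.
    have h : ∑' i : Fin k → ι, ENNReal.ofReal (formOfCoeff e c hc (fun j => e (i j)) ^ 2) ≠ ⊤ := by
      simp_rw [formOfCoeff_basis]
      exact hc.tsum_ofReal_ne_top
    rw [summable_iff_tsum_ofReal_ne_top fun i => sq_nonneg _]
    exact ne_top_of_le_ne_top h (tsum_ofReal_comp_sq_le e e' (.id ℝ H)
      ContinuousLinearMap.norm_id_le _)

end HilbertSchmidt

/-! ### Chaos decomposition and existence of the expansion -/

namespace IsGenGaussian

variable {Ω : Type*} [MeasurableSpace Ω] {P : Measure Ω} [IsProbabilityMeasure P]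
  {H : Type*} [NormedAddCommGroup H] [InnerProductSpace ℝ H] {ξ : H → Ω → ℝ} {ι : Type*}

/-- The homogeneous chaos of order `k`. -/
noncomputable def chaos (hξ : IsGenGaussian P ξ) (e : HilbertBasis ι ℝ H) (k : ℕ) :
    Submodule ℝ (Lp ℝ 2 P) :=
  (Submodule.span ℝ (Set.range fun i : Fin k → ι => hξ.wickLp e i)).topologicalClosure

theorem wickLp_mem_chaos (hξ : IsGenGaussian P ξ) (e : HilbertBasis ι ℝ H) {k : ℕ}
    (i : Fin k → ι) : hξ.wickLp e i ∈ hξ.chaos e k :=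
  Submodule.le_topologicalClosure _ (Submodule.subset_span ⟨i, rfl⟩)

theorem inner_eq_zero_of_mem_chaos (hξ : IsGenGaussian P ξ) (e : HilbertBasis ι ℝ H) (k l : ℕ)
    (hkl : k ≠ l) (x : Lp ℝ 2 P) (hx : x ∈ hξ.chaos e k) (y : Lp ℝ 2 P) (hy : y ∈ hξ.chaos e l) :
    inner ℝ x y = 0 := by
  have h1 : hξ.chaos e k ≤ (hξ.chaos e l)ᗮ := by
    rw [chaos, chaos, Submodule.orthogonal_closure]
    refine Submodule.topologicalClosure_minimal _ ?_ (Submodule.isClosed_orthogonal _)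
    refine Submodule.isOrtho_span.2 ?_
    rintro _ ⟨i, rfl⟩ _ ⟨j, rfl⟩
    simp only [wickLp]
    rw [inner_toLp, hξ.integral_wickProduct_mul_of_ne e i j hkl]
  exact Submodule.inner_left_of_mem_orthogonal hy (h1 hx)

/-- The chaos components `g k` of the exponential have squared norms `‖φ‖^(2k) / k!`. These sum to
`exp (‖φ‖²)`, the squared norm of the exponential itself, so nothing is left over. -/
theorem expVec_mem_closure_chaos (hξ : IsGenGaussian P ξ) (e : HilbertBasis ι ℝ H) (φ : H) :
    (hξ.memLp_expVec φ).toLp (expVec ξ φ) ∈ (⨆ k, hξ.chaos e k).topologicalClosure := by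
  set x := (hξ.memLp_expVec φ).toLp (expVec ξ φ) with hx
  have hxw : ∀ (k : ℕ) (i : Fin k → ι), inner ℝ x (hξ.wickLp e i) = ∏ j, inner ℝ (e (i j)) φ :=
    fun k i => by
      rw [hx, wickLp, inner_toLp, hξ.integral_expVec_mul_wickProduct]
  let d : (k : ℕ) → (Fin k → ι) → ℝ := fun k i =>
    (k.factorial : ℝ)⁻¹ * ∏ j, inner ℝ (e (i j)) φ
  have hs : ∀ k, Summable fun i : Fin k → ι => d k i • hξ.wickLp e i := fun k => by
    refine (hξ.isFockFamily_wickLp e k).summable ?_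
    have := ((hξ.isFockFamily_wickLp e k).summable_inner_sq x).mul_left ((k.factorial : ℝ)⁻¹ ^ 2)
    simpa only [hxw, ← mul_pow] using this
  choose g hg using hs
  have hgmem : ∀ k, g k ∈ hξ.chaos e k := fun k =>
    IsClosed.mem_of_tendsto (Submodule.isClosed_topologicalClosure _) (hg k)
      (Eventually.of_forall fun s => Submodule.sum_mem _ fun i _ =>
        Submodule.smul_mem _ _ (hξ.wickLp_mem_chaos e i))
  have hgw : ∀ (k : ℕ) (i : Fin k → ι), inner ℝ (g k) (hξ.wickLp e i) =
      ∏ j, inner ℝ (e (i j)) φ := fun k i => by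
    rw [(hξ.isFockFamily_wickLp e k).inner_of_hasSum (fun i σ => ?_) (hg k) i]
    · have : (k.factorial : ℝ) ≠ 0 := by positivity
      simp only [d]; field_simp
    · simp only [d]
      congr 1
      exact Equiv.prod_comp σ fun j => inner ℝ (e (i j)) φ
  -- Used for both `z = x` and `z = g k`, which have the same pairings with Wick products.
  have hval : ∀ (k : ℕ) (z : Lp ℝ 2 P),
      (∀ i : Fin k → ι, inner ℝ z (hξ.wickLp e i) = ∏ j, inner ℝ (e (i j)) φ) →
      inner ℝ z (g k) = (‖φ‖ ^ 2) ^ k / k.factorial := by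
    intro k z hz
    have h1 : HasSum (fun i => inner ℝ z (d k i • hξ.wickLp e i)) (inner ℝ z (g k)) :=
      (hg k).mapL (innerSL ℝ z)
    simp_rw [real_inner_smul_right, hz] at h1
    let A : ContinuousMultilinearMap ℝ (fun _ : Fin k => H) ℝ :=
      (k.factorial : ℝ)⁻¹ • (ContinuousMultilinearMap.mkPiAlgebra ℝ (Fin k)
        ℝ).compContinuousLinearMap fun _ => innerSL ℝ φ
    have hA : ∀ v, A v = (k.factorial : ℝ)⁻¹ * ∏ j, inner ℝ φ (v j) := fun v => by simp [A]
    have h2 := A.eq_of_hasSum_basis e (fun _ => φ) (y := inner ℝ z (g k)) (by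
      refine h1.congr_fun ?_
      intro i
      rw [hA]
      simp only [d]
      simp_rw [real_inner_comm])
    rw [h2, hA]
    simp only [real_inner_self_eq_norm_sq, Finset.prod_const, Finset.card_univ, Fintype.card_fin]
    rw [div_eq_inv_mul]
  have hxg := fun k => hval k x (hxw k)
  have hgg := fun k => hval k (g k) (hgw k)
  have hxx : inner ℝ x x = Real.exp (‖φ‖ ^ 2) := by
    rw [hx, inner_toLp, hξ.integral_expVec_mul_expVec, real_inner_self_eq_norm_sq]
  have hdist : ∀ N, ‖x - ∑ k ∈ Finset.range N, g k‖ ^ 2 =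
      Real.exp (‖φ‖ ^ 2) - ∑ k ∈ Finset.range N, (‖φ‖ ^ 2) ^ k / k.factorial := by
    intro N
    have h1 : inner ℝ x (∑ k ∈ Finset.range N, g k) =
        ∑ k ∈ Finset.range N, (‖φ‖ ^ 2) ^ k / k.factorial := by
      rw [inner_sum]; exact Finset.sum_congr rfl fun k _ => hxg k
    have h2 : ‖∑ k ∈ Finset.range N, g k‖ ^ 2 =
        ∑ k ∈ Finset.range N, (‖φ‖ ^ 2) ^ k / k.factorial := by
      rw [← real_inner_self_eq_norm_sq, sum_inner]
      refine Finset.sum_congr rfl fun k hk => ?_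
      rw [inner_sum, Finset.sum_eq_single_of_mem k hk, hgg]
      intro l _ hl
      exact hξ.inner_eq_zero_of_mem_chaos e k l hl.symm _ (hgmem k) _ (hgmem l)
    rw [norm_sub_sq_real, h1, h2, ← real_inner_self_eq_norm_sq x, hxx]
    ring
  have hexp := (NormedSpace.expSeries_div_hasSum_exp (𝔸 := ℝ) (‖φ‖ ^ 2)).tendsto_sum_nat
  rw [← Real.exp_eq_exp_ℝ] at hexp
  have hlim : Tendsto (fun N => ∑ k ∈ Finset.range N, g k) atTop (𝓝 x) := by
    rw [tendsto_iff_norm_sub_tendsto_zero]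
    have h1 : Tendsto (fun N => √(‖x - ∑ k ∈ Finset.range N, g k‖ ^ 2)) atTop (𝓝 0) := by
      simp_rw [hdist]
      have := (hexp.const_sub (Real.exp (‖φ‖ ^ 2))).sqrt
      simpa using this
    refine h1.congr fun N => ?_
    rw [Real.sqrt_sq (norm_nonneg _), norm_sub_rev]
  refine mem_closure_of_tendsto hlim (Eventually.of_forall fun N => ?_)
  exact Submodule.sum_mem _ fun k _ => Submodule.mem_iSup_of_mem k (hgmem k)

theorem aestronglyMeasurable_of_mem_closure_chaos (hξ : IsGenGaussian P ξ)
    (e : HilbertBasis ι ℝ H) {x : Lp ℝ 2 P} (hx : x ∈ (⨆ k, hξ.chaos e k).topologicalClosure) :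
    AEStronglyMeasurable[sigmaOf ξ] x P := by
  have hcl : IsClosed (lpMeas ℝ ℝ (sigmaOf ξ) 2 P : Set (Lp ℝ 2 P)) :=
    isClosed_aestronglyMeasurable hξ.sigmaOf_le
  have h1 : (⨆ k, hξ.chaos e k).topologicalClosure ≤ lpMeas ℝ ℝ (sigmaOf ξ) 2 P := by
    refine Submodule.topologicalClosure_minimal _ (iSup_le fun k => ?_) hcl
    refine Submodule.topologicalClosure_minimal _ (Submodule.span_le.2 ?_) hcl
    rintro _ ⟨i, rfl⟩
    refine mem_lpMeas_iff_aestronglyMeasurable.2 ?_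
    refine AEStronglyMeasurable.congr ?_ (hξ.memLp_wickProduct e i).coeFn_toLp.symm
    exact (measurable_wickProduct ξ e i).stronglyMeasurable.aestronglyMeasurable
  exact mem_lpMeas_iff_aestronglyMeasurable.1 (h1 hx)

/-- The component orthogonal to all chaoses is still `σ(ξ)`-measurable and is orthogonal to every
exponential, hence zero by totality. -/
theorem toLp_mem_closure_chaos (hξ : IsGenGaussian P ξ) (e : HilbertBasis ι ℝ H) {α : Ω → ℝ}
    (hα : MemLp α 2 P) (hm : AEStronglyMeasurable[sigmaOf ξ] α P) :
    hα.toLp α ∈ (⨆ k, hξ.chaos e k).topologicalClosure := by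
  set K := (⨆ k, hξ.chaos e k).topologicalClosure with hK
  have : CompleteSpace K := (Submodule.isClosed_topologicalClosure _).completeSpace_coe
  obtain ⟨y, hy, z, hz, hyz⟩ := K.exists_add_mem_mem_orthogonal (hα.toLp α)
  have hzm : AEStronglyMeasurable[sigmaOf ξ] z P := by
    have h1 := hξ.aestronglyMeasurable_of_mem_closure_chaos e hy
    refine (hm.sub h1).congr ?_
    have h2 : z = hα.toLp α - y := by rw [hyz, add_sub_cancel_left]
    rw [h2]
    filter_upwards [Lp.coeFn_sub (hα.toLp α) y, hα.coeFn_toLp] with ω h3 h4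
    rw [h3, Pi.sub_apply, Pi.sub_apply, h4]
  have hz0 : z = 0 := by
    refine Lp.ext ?_
    refine (hξ.ae_eq_zero_of_integral_expVec_mul (Lp.memLp z) hzm fun φ => ?_).trans
      (Lp.coeFn_zero _ _ _).symm
    have h1 := Submodule.inner_right_of_mem_orthogonal (hξ.expVec_mem_closure_chaos e φ) hz
    rw [← h1, inner_eq_integral]
    refine integral_congr_ae ?_
    filter_upwards [(hξ.memLp_expVec φ).coeFn_toLp] with ω hω
    rw [hω]
  rw [hyz, hz0, add_zero]
  exact hy

theorem exists_isHermiteValue_of_mem_chaos [CompleteSpace H] (hξ : IsGenGaussian P ξ)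
    (e : HilbertBasis ι ℝ H) {k : ℕ} {x : Lp ℝ 2 P} (hx : x ∈ hξ.chaos e k) :
    ∃ A : ContinuousMultilinearMap ℝ (fun _ : Fin k => H) ℝ,
      IsSymmHilbertSchmidt A ∧ IsHermiteValue P ξ A x := by
  have hF := hξ.isFockFamily_wickLp e k
  let c : (Fin k → ι) → ℝ := fun i => (k.factorial : ℝ)⁻¹ * inner ℝ x (hξ.wickLp e i)
  have hc : Summable fun i => c i ^ 2 := by
    have := (hF.summable_inner_sq x).mul_left ((k.factorial : ℝ)⁻¹ ^ 2)
    simpa only [← mul_pow] using this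
  have hA : IsSymmHilbertSchmidt (formOfCoeff e c hc) :=
    isSymmHilbertSchmidt_formOfCoeff e c hc fun i σ => by simp only [c]; rw [hF.comp_perm]
  have hsum : HasSumL2 P (fun i ω => c i * wickProduct ξ e i ω) x := by
    rw [hξ.hasSumL2_wickProduct_iff e _ (Lp.memLp x), Lp.toLp_coeFn]
    exact hF.hasSum_of_mem hx
  refine ⟨_, hA, hξ.isHermiteValue_of_integral hA (Lp.memLp x)
    (hξ.aestronglyMeasurable_of_hasSumL2 e _ hsum) fun φ => ?_⟩
  rw [formOfCoeff_apply]
  exact (hξ.hasSum_integral_expVec_mul e _ hsum φ).tsum_eq.symm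

/-- Every square integrable functional of `ξ` has an Itô-Wiener expansion. -/
theorem exists_isItoWienerExpansion [CompleteSpace H] (hξ : IsGenGaussian P ξ)
    (e : HilbertBasis ι ℝ H) {α : Ω → ℝ} (hα : MemLp α 2 P)
    (hm : AEStronglyMeasurable[sigmaOf ξ] α P) : ∃ A, IsItoWienerExpansion P ξ A α := by
  obtain ⟨a, ha, hsum⟩ := exists_hasSum_of_mem_closure_iSup
    (fun k => Submodule.isClosed_topologicalClosure _) (hξ.inner_eq_zero_of_mem_chaos e)
    (hξ.toLp_mem_closure_chaos e hα hm)
  choose A hA hAv using fun k => hξ.exists_isHermiteValue_of_mem_chaos e (ha k)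
  refine ⟨A, hA, fun k => a k, hAv, ?_⟩
  rw [hasSumL2_iff (fun k => Lp.memLp (a k)) hα]
  simpa only [Lp.toLp_coeFn] using hsum

end IsGenGaussian

/-! ### A self-adjoint root of `1 - C C*` by power series -/

section SquareRoot

/-- The coefficients of the power series of `(1 - √(1 - x)) / x`. -/
noncomputable def sqrtCoeff (n : ℕ) : ℝ := catalan n / 2 ^ (2 * n + 1)

theorem sqrtCoeff_nonneg (n : ℕ) : 0 ≤ sqrtCoeff n := by unfold sqrtCoeff; positivity

/-- The Catalan recursion, that is, the functional equation `x D(x)² = 2 D(x) - 1` in coefficients.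
-/
theorem sum_antidiagonal_sqrtCoeff (n : ℕ) :
    ∑ p ∈ Finset.HasAntidiagonal.antidiagonal n, sqrtCoeff p.1 * sqrtCoeff p.2 = 2 * sqrtCoeff (n + 1) := by
  unfold sqrtCoeff
  rw [catalan_succ']
  push_cast
  rw [Finset.sum_div, Finset.mul_sum]
  refine Finset.sum_congr rfl fun p hp => ?_
  rw [← Finset.HasAntidiagonal.mem_antidiagonal.1 hp]
  field_simp
  ring

/-- The convolution identity gives `s_{N+1} ≤ 1/2 + s_N² / 2` for the partial sums, which keeps them
below the fixed point `1`. -/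
theorem sum_range_sqrtCoeff_le (N : ℕ) : ∑ n ∈ Finset.range N, sqrtCoeff n ≤ 1 := by
  induction N with
  | zero => simp
  | succ N ih =>
    have h0 : 0 ≤ ∑ n ∈ Finset.range N, sqrtCoeff n :=
      Finset.sum_nonneg fun n _ => sqrtCoeff_nonneg n
    have h1 : ∑ n ∈ Finset.range N, 2 * sqrtCoeff (n + 1) ≤
        (∑ n ∈ Finset.range N, sqrtCoeff n) * ∑ n ∈ Finset.range N, sqrtCoeff n := by
      rw [Finset.sum_mul_sum, ← Finset.sum_product']
      simp_rw [← sum_antidiagonal_sqrtCoeff]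
      rw [Finset.sum_sigma' (Finset.range N) fun n => Finset.HasAntidiagonal.antidiagonal n]
      refine (Finset.sum_image (s := (Finset.range N).sigma fun n => Finset.HasAntidiagonal.antidiagonal n)
        (g := fun p => p.2) (f := fun p : ℕ × ℕ => sqrtCoeff p.1 * sqrtCoeff p.2) ?_).symm.trans_le ?_
      · rintro ⟨n, p⟩ hp ⟨m, q⟩ hq h
        simp only [Finset.coe_sigma, Set.mem_sigma_iff, Finset.mem_coe,
          Finset.HasAntidiagonal.mem_antidiagonal] at hp hq h
        obtain ⟨-, rfl⟩ := hp
        obtain ⟨-, rfl⟩ := hq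
        subst h
        rfl
      · refine Finset.sum_le_sum_of_subset_of_nonneg ?_ fun p _ _ =>
          mul_nonneg (sqrtCoeff_nonneg _) (sqrtCoeff_nonneg _)
        intro p hp
        obtain ⟨⟨n, q⟩, hq, rfl⟩ := Finset.mem_image.1 hp
        simp only [Finset.mem_sigma, Finset.mem_range, Finset.HasAntidiagonal.mem_antidiagonal] at hq
        simp only [Finset.mem_product, Finset.mem_range]
        omega
    rw [← Finset.mul_sum] at h1
    rw [Finset.sum_range_succ']
    have h2 : sqrtCoeff 0 = 1 / 2 := by simp [sqrtCoeff]
    rw [h2]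
    nlinarith

theorem summable_sqrtCoeff : Summable sqrtCoeff :=
  summable_of_sum_range_le sqrtCoeff_nonneg sum_range_sqrtCoeff_le

/-- A self-adjoint contraction `T` has a self-adjoint square root of `1 - T`. -/
theorem exists_isSelfAdjoint_mul_self_eq {R : Type*} [NormedRing R] [NormedAlgebra ℝ R]
    [CompleteSpace R] [StarRing R] [ContinuousStar R] [StarModule ℝ R] {T : R}
    (hT : IsSelfAdjoint T) (hT1 : ∀ n, ‖T ^ n‖ ≤ 1) :
    ∃ S : R, IsSelfAdjoint S ∧ S * S = 1 - T := by
  have hn : Summable fun n => ‖sqrtCoeff n • T ^ n‖ := by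
    refine Summable.of_nonneg_of_le (fun _ => norm_nonneg _) (fun n => ?_) summable_sqrtCoeff
    rw [norm_smul, Real.norm_of_nonneg (sqrtCoeff_nonneg n)]
    exact mul_le_of_le_one_right (sqrtCoeff_nonneg n) (hT1 n)
  have hs : Summable fun n => sqrtCoeff n • T ^ n := hn.of_norm
  set D := ∑' n, sqrtCoeff n • T ^ n with hD
  have hcomm : T * D = D * T := by
    rw [hD, ← hs.tsum_mul_left, ← hs.tsum_mul_right]
    refine tsum_congr fun n => ?_
    rw [mul_smul_comm, smul_mul_assoc, ← pow_succ, ← pow_succ']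
  have hsq : T * (D * D) = 2 • D - 1 := by
    rw [hD, tsum_mul_tsum_eq_tsum_sum_antidiagonal_of_summable_norm hn hn]
    have e : ∀ n, ∑ p ∈ Finset.HasAntidiagonal.antidiagonal n, sqrtCoeff p.1 • T ^ p.1 * sqrtCoeff p.2 • T ^ p.2 =
        (2 * sqrtCoeff (n + 1)) • T ^ n := by
      intro n
      rw [← sum_antidiagonal_sqrtCoeff, Finset.sum_smul]
      refine Finset.sum_congr rfl fun p hp => ?_
      rw [smul_mul_smul_comm, ← pow_add, Finset.HasAntidiagonal.mem_antidiagonal.1 hp]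
    have hs2 : Summable fun n => (2 * sqrtCoeff (n + 1)) • T ^ n := by
      refine Summable.of_norm_bounded
        (((summable_nat_add_iff 1).2 summable_sqrtCoeff).mul_left 2) fun n => ?_
      have h0 : 0 ≤ 2 * sqrtCoeff (n + 1) := mul_nonneg zero_le_two (sqrtCoeff_nonneg _)
      rw [norm_smul, Real.norm_of_nonneg h0]
      exact mul_le_of_le_one_right h0 (hT1 n)
    simp_rw [e]
    rw [← hs2.tsum_mul_left, hs.tsum_eq_zero_add]
    have e2 : ∀ n, T * (2 * sqrtCoeff (n + 1)) • T ^ n = (2 : ℝ) • sqrtCoeff (n + 1) • T ^ (n + 1) := by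
      intro n; rw [mul_smul_comm, ← pow_succ', mul_smul]
    simp_rw [e2]
    rw [tsum_const_smul'']
    have h2 : sqrtCoeff 0 = 1 / 2 := by simp [sqrtCoeff]
    rw [h2, pow_zero, smul_add, two_smul ℝ, two_smul ℕ, ← two_nsmul ((1 / 2 : ℝ) • (1 : R))]
    rw [← Nat.cast_smul_eq_nsmul ℝ 2 ((1 / 2 : ℝ) • (1 : R)), smul_smul]
    norm_num
    rw [two_mul]
  have hDs : IsSelfAdjoint D := by
    rw [isSelfAdjoint_iff, hD, tsum_star]
    refine tsum_congr fun n => ?_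
    rw [star_smul, star_pow, hT.star_eq]
    simp
  -- With `T D² = 2D - 1` one gets `(1 - T D)² = 1 - 2 T D + T (2D - 1) = 1 - T`.
  refine ⟨1 - T * D, ?_, ?_⟩
  · rw [isSelfAdjoint_iff, star_sub, star_mul, hT.star_eq, hDs.star_eq, star_one, hcomm]
  · have h3 : T * D * (T * D) = T * (T * (D * D)) := by
      rw [mul_assoc, ← mul_assoc D T D, ← hcomm, mul_assoc]
    rw [sub_mul, mul_sub, mul_sub, h3, hsq]
    simp only [mul_sub, one_mul, mul_one, mul_smul_comm]
    rw [two_nsmul]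
    abel

theorem exists_sqrt_one_sub_comp_adjoint {H : Type*} [NormedAddCommGroup H] [InnerProductSpace ℝ H]
    [CompleteSpace H] (C : H →L[ℝ] H) (hC : ‖C‖ ≤ 1) :
    ∃ S : H →L[ℝ] H, IsSelfAdjoint S ∧ S ∘L S = 1 - C ∘L ContinuousLinearMap.adjoint C := by
  have h1 : ∀ n, ‖(C * star C) ^ n‖ ≤ 1 := by
    intro n
    induction n with
    | zero => exact ContinuousLinearMap.norm_id_le
    | succ n ih =>
      rw [pow_succ]
      refine (norm_mul_le _ _).trans (mul_le_one₀ ih (norm_nonneg _) ?_)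
      exact (norm_mul_le _ _).trans (mul_le_one₀ hC (norm_nonneg _) 
        ((LinearIsometryEquiv.norm_map ContinuousLinearMap.adjoint C).trans_le hC))
  exact exists_isSelfAdjoint_mul_self_eq (IsSelfAdjoint.mul_star_self C) h1

/-- Evaluate the quadratic form of `S² + C C* = 1` at `φ`. Every equality of law between `η` and `ξ`
uses the root through this identity. -/
theorem norm_sq_add_norm_sq_of_sqrt {H : Type*} [NormedAddCommGroup H] [InnerProductSpace ℝ H]
    [CompleteSpace H] {C S : H →L[ℝ] H} (hS : IsSelfAdjoint S)
    (hSC : S ∘L S = 1 - C ∘L ContinuousLinearMap.adjoint C) (φ : H) :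
    ‖ContinuousLinearMap.adjoint C φ‖ ^ 2 + ‖S φ‖ ^ 2 = ‖φ‖ ^ 2 := by
  have h1 : inner ℝ (S φ) (S φ) = inner ℝ ((S ∘L S) φ) φ := by
    have := ContinuousLinearMap.adjoint_inner_left S (S φ) φ
    rw [hS.adjoint_eq] at this
    rw [ContinuousLinearMap.comp_apply, this, real_inner_comm]
  rw [hSC] at h1
  simp only [sub_apply, one_apply_eq_self,
    ContinuousLinearMap.comp_apply, inner_sub_left, real_inner_self_eq_norm_sq] at h1
  rw [← ContinuousLinearMap.adjoint_inner_right, real_inner_self_eq_norm_sq] at h1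
  linarith

end SquareRoot

/-! ### Mehler's formula -/

namespace IsExpField

variable {Ω Ω' : Type*} [MeasurableSpace Ω] [MeasurableSpace Ω'] {P : Measure Ω} {P' : Measure Ω'}
  [IsFiniteMeasure P] [IsFiniteMeasure P'] {H : Type*} [AddCommGroup H] [Module ℝ H]
  {U : H → Ω → ℝ} {V : H → Ω' → ℝ}

theorem add_prod (hU : IsExpField P U) (hV : IsExpField P' V) :
    IsExpField (P.prod P') fun φ ω => U φ ω.1 + V φ ω.2 where
  measurable φ := ((hU.measurable φ).comp measurable_fst).add ((hV.measurable φ).comp measurable_snd)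
  linear a b φ ψ := by
    filter_upwards [Measure.quasiMeasurePreserving_fst.ae (hU.linear a b φ ψ),
      Measure.quasiMeasurePreserving_snd.ae (hV.linear a b φ ψ)] with ω h1 h2
    rw [h1, h2]; ring
  integrable_exp φ := by
    simp_rw [Real.exp_add]
    exact (hU.integrable_exp φ).mul_prod (hV.integrable_exp φ)

theorem integral_exp_add_prod (φ : H) :
    ∫ ω, Real.exp (U φ ω.1 + V φ ω.2) ∂(P.prod P') =
      (∫ ω, Real.exp (U φ ω) ∂P) * ∫ ω, Real.exp (V φ ω) ∂P' := by
  simp_rw [Real.exp_add]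
  exact integral_prod_mul (fun ω => Real.exp (U φ ω)) fun ω => Real.exp (V φ ω)

theorem comp_linear (hU : IsExpField P U) {H' : Type*} [AddCommGroup H'] [Module ℝ H']
    (T : H' →ₗ[ℝ] H) : IsExpField P fun φ => U (T φ) where
  measurable φ := hU.measurable _
  linear a b φ ψ := by
    have := hU.linear a b (T φ) (T ψ)
    rwa [← map_smul, ← map_smul, ← map_add] at this
  integrable_exp φ := hU.integrable_exp _

end IsExpField

section Mehler

variable {Ω : Type*} [MeasurableSpace Ω] {P : Measure Ω} [IsProbabilityMeasure P]
  {H : Type*} [NormedAddCommGroup H] [InnerProductSpace ℝ H] [CompleteSpace H] {ξ : H → Ω → ℝ}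
  {C S : H →L[ℝ] H}

/-- The field `(φ, η) = (S φ, ξ') + (C* φ, ξ)` on the product space, with `ξ'` an independent copy
of `ξ`. -/
noncomputable def mehlerField (S C : H →L[ℝ] H) (ξ : H → Ω → ℝ) (φ : H) (ω : Ω × Ω) : ℝ :=
  ξ (ContinuousLinearMap.adjoint C φ) ω.1 + ξ (S φ) ω.2

/-- Mehler's formula for the second quantization of a functional. -/
noncomputable def mehler (P : Measure Ω) (S C : H →L[ℝ] H) (ξ : H → Ω → ℝ) (a : (H → ℝ) → ℝ)
    (ω : Ω) : ℝ :=
  ∫ ω', a (fun φ => mehlerField S C ξ φ (ω, ω')) ∂P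

namespace IsGenGaussian

theorem measurable_mehlerField (hξ : IsGenGaussian P ξ) :
    Measurable fun ω φ => mehlerField S C ξ φ ω :=
  measurable_pi_lambda _ fun _ =>
    ((hξ.measurable _).comp measurable_fst).add ((hξ.measurable _).comp measurable_snd)

theorem isExpField_mehlerField (hξ : IsGenGaussian P ξ) :
    IsExpField (P.prod P) (mehlerField S C ξ) :=
  (hξ.isExpField.comp_linear (ContinuousLinearMap.adjoint C).toLinearMap).add_prod
    (hξ.isExpField.comp_linear S.toLinearMap)

theorem map_mehlerField (hξ : IsGenGaussian P ξ)
    (hS : ∀ φ, ‖ContinuousLinearMap.adjoint C φ‖ ^ 2 + ‖S φ‖ ^ 2 = ‖φ‖ ^ 2) :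
    (P.prod P).map (fun ω φ => mehlerField S C ξ φ ω) = P.map fun ω φ => ξ φ ω := by
  refine hξ.isExpField_mehlerField.map_eq hξ.isExpField fun φ => ?_
  have h := IsExpField.integral_exp_add_prod (P := P) (P' := P)
    (U := fun φ => ξ (ContinuousLinearMap.adjoint C φ)) (V := fun φ => ξ (S φ)) φ
  rw [hξ.integral_exp, hξ.integral_exp, ← Real.exp_add, ← add_div, hS, ← hξ.integral_exp] at h
  exact h

/-- Under the Cameron-Martin density in the direction `φ`, the field `η` has the law of `ξ` under
the Cameron-Martin density in the direction `C φ`. -/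
theorem map_withDensity_mehlerField (hξ : IsGenGaussian P ξ)
    (hS : ∀ φ, ‖ContinuousLinearMap.adjoint C φ‖ ^ 2 + ‖S φ‖ ^ 2 = ‖φ‖ ^ 2) (φ : H) :
    ((P.withDensity fun ω => ENNReal.ofReal (expVec ξ φ ω)).prod P).map
        (fun ω ψ => mehlerField S C ξ ψ ω) =
      (P.withDensity fun ω => ENNReal.ofReal (expVec ξ (C φ) ω)).map fun ω ψ => ξ ψ ω := by
  have := isFiniteMeasure_withDensity_of_memLp (hξ.memLp_expVec φ)
  have := isFiniteMeasure_withDensity_of_memLp (hξ.memLp_expVec (C φ))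
  have hU : IsExpField ((P.withDensity fun ω => ENNReal.ofReal (expVec ξ φ ω)).prod P)
      (mehlerField S C ξ) :=
    ((hξ.isExpField_withDensity φ).comp_linear
      (ContinuousLinearMap.adjoint C).toLinearMap).add_prod
      (hξ.isExpField.comp_linear S.toLinearMap)
  -- The exponents agree because `⟨C* ψ, φ⟩ = ⟨ψ, C φ⟩` and the squared norms add up to `‖ψ‖²`.
  refine hU.map_eq (hξ.isExpField_withDensity (C φ)) fun ψ => ?_
  have h := IsExpField.integral_exp_add_prod
    (P := P.withDensity fun ω => ENNReal.ofReal (expVec ξ φ ω)) (P' := P)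
    (U := fun φ => ξ (ContinuousLinearMap.adjoint C φ)) (V := fun φ => ξ (S φ)) ψ
  refine h.trans ?_
  rw [integral_withDensity_ofReal (hξ.measurable_expVec φ) (fun _ => (Real.exp_pos _).le),
    integral_withDensity_ofReal (hξ.measurable_expVec _) (fun _ => (Real.exp_pos _).le),
    hξ.integral_expVec_mul_exp, hξ.integral_expVec_mul_exp, hξ.integral_exp, ← Real.exp_add,
    ContinuousLinearMap.adjoint_inner_left, ← hS ψ]
  ring_nf

variable {a : (H → ℝ) → ℝ}

theorem memLp_comp_mehlerField (hξ : IsGenGaussian P ξ)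
    (hS : ∀ φ, ‖ContinuousLinearMap.adjoint C φ‖ ^ 2 + ‖S φ‖ ^ 2 = ‖φ‖ ^ 2) (ha : Measurable a)
    (hL : MemLp (fun ω => a fun φ => ξ φ ω) 2 P) :
    MemLp (fun ω => a fun φ => mehlerField S C ξ φ ω) 2 (P.prod P) := by
  have h1 : MemLp a 2 (P.map fun ω φ => ξ φ ω) :=
    (memLp_map_measure_iff ha.aestronglyMeasurable hξ.measurable_field.aemeasurable).2 hL
  rw [← hξ.map_mehlerField hS] at h1
  exact (memLp_map_measure_iff ha.aestronglyMeasurable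
    hξ.measurable_mehlerField.aemeasurable).1 h1

theorem eLpNorm_comp_mehlerField (hξ : IsGenGaussian P ξ)
    (hS : ∀ φ, ‖ContinuousLinearMap.adjoint C φ‖ ^ 2 + ‖S φ‖ ^ 2 = ‖φ‖ ^ 2) (ha : Measurable a) :
    eLpNorm (fun ω => a fun φ => mehlerField S C ξ φ ω) 2 (P.prod P) =
      eLpNorm (fun ω => a fun φ => ξ φ ω) 2 P := by
  have h1 := eLpNorm_map_measure (p := 2) (μ := P.prod P) (g := a)
    (f := fun ω φ => mehlerField S C ξ φ ω) ha.aestronglyMeasurable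
    hξ.measurable_mehlerField.aemeasurable
  have h2 := eLpNorm_map_measure (p := 2) (μ := P) (g := a) (f := fun ω φ => ξ φ ω)
    ha.aestronglyMeasurable hξ.measurable_field.aemeasurable
  rw [hξ.map_mehlerField hS, h2] at h1
  exact h1.symm

theorem measurable_field_sigmaOf (ξ : H → Ω → ℝ) : Measurable[sigmaOf ξ] fun ω φ => ξ φ ω := by
  rw [sigmaOf_eq_comap]; exact comap_measurable _

theorem stronglyMeasurable_mehler (hξ : IsGenGaussian P ξ) (ha : Measurable a) :
    StronglyMeasurable[sigmaOf ξ] (mehler P S C ξ a) := by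
  have h1 : Measurable fun p : (H → ℝ) × Ω =>
      a fun φ => p.1 (ContinuousLinearMap.adjoint C φ) + ξ (S φ) p.2 :=
    ha.comp (measurable_pi_lambda _ fun φ => ((measurable_pi_apply _).comp measurable_fst).add
      ((hξ.measurable _).comp measurable_snd))
  exact (h1.stronglyMeasurable.integral_prod_right' (ν := P)).comp_measurable
    (measurable_field_sigmaOf ξ)

theorem _root_.eLpNorm_two_rpow {X : Type*} [MeasurableSpace X] (ν : Measure X) (g : X → ℝ) :
    eLpNorm g 2 ν ^ (2 : ℝ) = ∫⁻ x, ‖g x‖ₑ ^ (2 : ℝ) ∂ν := by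
  rw [eLpNorm_eq_lintegral_rpow_enorm_toReal (by norm_num) (by norm_num), ← ENNReal.rpow_mul]
  simp

/-- On each fibre, a probability space, the `L¹` norm is at most the `L²` norm; Tonelli then
assembles the fibres. -/
theorem _root_.eLpNorm_integral_prod_le {Ω' : Type*} [MeasurableSpace Ω'] {P' : Measure Ω'}
    [IsProbabilityMeasure P'] {f : Ω × Ω' → ℝ} (hf : Measurable f) :
    eLpNorm (fun ω => ∫ ω', f (ω, ω') ∂P') 2 P ≤ eLpNorm f 2 (P.prod P') := by
  rw [← ENNReal.rpow_le_rpow_iff (z := 2) (by norm_num), eLpNorm_two_rpow, eLpNorm_two_rpow]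
  rw [lintegral_prod _ (by fun_prop)]
  refine lintegral_mono fun ω => ?_
  rw [← eLpNorm_two_rpow]
  gcongr
  calc ‖∫ ω', f (ω, ω') ∂P'‖ₑ ≤ ∫⁻ ω', ‖f (ω, ω')‖ₑ ∂P' := enorm_integral_le_lintegral_enorm _
    _ = eLpNorm (fun ω' => f (ω, ω')) 1 P' := eLpNorm_one_eq_lintegral_enorm.symm
    _ ≤ _ := eLpNorm_le_eLpNorm_of_exponent_le (by norm_num)
        (hf.comp measurable_prodMk_left).aestronglyMeasurable

theorem eLpNorm_mehler_le (hξ : IsGenGaussian P ξ)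
    (hS : ∀ φ, ‖ContinuousLinearMap.adjoint C φ‖ ^ 2 + ‖S φ‖ ^ 2 = ‖φ‖ ^ 2) (ha : Measurable a) :
    eLpNorm (mehler P S C ξ a) 2 P ≤ eLpNorm (fun ω => a fun φ => ξ φ ω) 2 P := by
  rw [← hξ.eLpNorm_comp_mehlerField hS ha]
  exact eLpNorm_integral_prod_le (f := fun ω => a fun φ => mehlerField S C ξ φ ω)
    (ha.comp hξ.measurable_mehlerField)

theorem memLp_mehler (hξ : IsGenGaussian P ξ)
    (hS : ∀ φ, ‖ContinuousLinearMap.adjoint C φ‖ ^ 2 + ‖S φ‖ ^ 2 = ‖φ‖ ^ 2) (ha : Measurable a)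
    (hL : MemLp (fun ω => a fun φ => ξ φ ω) 2 P) : MemLp (mehler P S C ξ a) 2 P :=
  ⟨((hξ.stronglyMeasurable_mehler ha).mono hξ.sigmaOf_le).aestronglyMeasurable,
    (hξ.eLpNorm_mehler_le hS ha).trans_lt hL.2⟩

/-- Read `E_φ` as a density on the first factor: by Fubini the left side integrates `a` over the
field of `map_withDensity_mehlerField`, whose law is that of `ξ` under `E_{Cφ}`. -/
theorem integral_expVec_mul_mehler (hξ : IsGenGaussian P ξ)
    (hS : ∀ φ, ‖ContinuousLinearMap.adjoint C φ‖ ^ 2 + ‖S φ‖ ^ 2 = ‖φ‖ ^ 2) (ha : Measurable a)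
    (hL : MemLp (fun ω => a fun φ => ξ φ ω) 2 P) (φ : H) :
    ∫ ω, expVec ξ φ ω * mehler P S C ξ a ω ∂P =
      ∫ ω, expVec ξ (C φ) ω * a (fun ψ => ξ ψ ω) ∂P := by
  have := isFiniteMeasure_withDensity_of_memLp (hξ.memLp_expVec φ)
  have hpos : ∀ ψ ω, 0 ≤ expVec ξ ψ ω := fun ψ ω => (Real.exp_pos _).le
  have hmap := hξ.map_withDensity_mehlerField hS φ
  have hint : Integrable (fun ω => a fun ψ => ξ ψ ω)
      (P.withDensity fun ω => ENNReal.ofReal (expVec ξ (C φ) ω)) := by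
    rw [integrable_withDensity_iff_integrable_smul₀'
      (hξ.measurable_expVec _).ennreal_ofReal.aemeasurable (by simp)]
    refine (integrable_mul_of_memLp_two (hξ.memLp_expVec (C φ)) hL).congr (ae_of_all _ fun ω => ?_)
    simp [ENNReal.toReal_ofReal (hpos _ ω)]
  have hint' : Integrable (fun ω => a fun ψ => mehlerField S C ξ ψ ω)
      ((P.withDensity fun ω => ENNReal.ofReal (expVec ξ φ ω)).prod P) := by
    have h1 := (integrable_map_measure (f := fun ω ψ => ξ ψ ω) ha.aestronglyMeasurable
      hξ.measurable_field.aemeasurable).2 hint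
    rw [← hmap] at h1
    exact (integrable_map_measure ha.aestronglyMeasurable
      hξ.measurable_mehlerField.aemeasurable).1 h1
  rw [← integral_withDensity_ofReal (hξ.measurable_expVec φ) (hpos φ),
    ← integral_withDensity_ofReal (hξ.measurable_expVec (C φ)) (hpos (C φ)),
    ← integral_map (f := a) (φ := fun ω ψ => ξ ψ ω) hξ.measurable_field.aemeasurable
      ha.aestronglyMeasurable, ← hmap,
    integral_map hξ.measurable_mehlerField.aemeasurable ha.aestronglyMeasurable,
    integral_prod _ hint']
  rfl

/-- Linearity holds only almost everywhere, on the fibres where all integrands are integrable. -/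
theorem sum_mehler_sub_ae_eq (hξ : IsGenGaussian P ξ)
    (hS : ∀ φ, ‖ContinuousLinearMap.adjoint C φ‖ ^ 2 + ‖S φ‖ ^ 2 = ‖φ‖ ^ 2)
    {κ : Type*} {b : κ → (H → ℝ) → ℝ} (hb : ∀ k, Measurable (b k))
    (hbL : ∀ k, MemLp (fun ω => b k fun φ => ξ φ ω) 2 P) (ha : Measurable a)
    (hL : MemLp (fun ω => a fun φ => ξ φ ω) 2 P) (s : Finset κ) :
    (fun ω => ∑ k ∈ s, mehler P S C ξ (b k) ω - mehler P S C ξ a ω) =ᵐ[P]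
      mehler P S C ξ (fun z => ∑ k ∈ s, b k z - a z) := by
  have h1 := fun k =>
    ((hξ.memLp_comp_mehlerField hS (hb k) (hbL k)).integrable (by norm_num)).prod_right_ae
  have h2 := ((hξ.memLp_comp_mehlerField hS ha hL).integrable (by norm_num)).prod_right_ae
  filter_upwards [(Finset.eventually_all s).2 fun k _ => h1 k, h2] with ω h1 h2
  simp only [mehler]
  rw [integral_sub (integrable_finsetSum _ h1) h2, integral_finsetSum _ h1]

/-- Mehler's formula gives the second quantization. -/
theorem isItoWienerExpansion_mehler [TopologicalSpace.SeparableSpace H] (hξ : IsGenGaussian P ξ)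
    (hC : ‖C‖ ≤ 1) (hS : ∀ φ, ‖ContinuousLinearMap.adjoint C φ‖ ^ 2 + ‖S φ‖ ^ 2 = ‖φ‖ ^ 2)
    (ha : Measurable a) (hL : MemLp (fun ω => a fun φ => ξ φ ω) 2 P)
    {A : (k : ℕ) → ContinuousMultilinearMap ℝ (fun _ : Fin k => H) ℝ}
    (hA : IsItoWienerExpansion P ξ A fun ω => a fun φ => ξ φ ω) :
    IsItoWienerExpansion P ξ (fun k => (A k).compContinuousLinearMap fun _ => C)
      (mehler P S C ξ a) := by
  obtain ⟨ι, ⟨e⟩⟩ := exists_countable_hilbertBasis H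
  obtain ⟨hHS, α, hα, hsum⟩ := hA
  have hαL : ∀ k, MemLp (α k) 2 P := fun k => (hα k e).1
  -- The transform acts on functions of the path, so each chaos component needs such a
  -- representative.
  have hrep : ∀ k, ∃ b : (H → ℝ) → ℝ, Measurable b ∧ α k =ᵐ[P] fun ω => b fun φ => ξ φ ω := by
    intro k
    obtain ⟨β, hβ, hαβ⟩ := IsHermiteValue.aestronglyMeasurable (hα k) hξ e
    have hβm := hβ.measurable
    rw [sigmaOf_eq_comap] at hβm
    obtain ⟨b, hb, rfl⟩ := hβm.exists_eq_measurable_comp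
    exact ⟨b, hb, hαβ⟩
  choose b hb hαb using hrep
  have hbL : ∀ k, MemLp (fun ω => b k fun φ => ξ φ ω) 2 P := fun k => (hαL k).ae_eq (hαb k)
  refine ⟨fun k => (hHS k).comp C hC, fun k => mehler P S C ξ (b k), fun k => ?_, ?_, ?_⟩
  · refine hξ.isHermiteValue_of_integral ((hHS k).comp C hC) (hξ.memLp_mehler hS (hb k) (hbL k))
      (hξ.stronglyMeasurable_mehler (hb k)).aestronglyMeasurable fun φ => ?_
    -- The pairing becomes that of `α k` with `E_{Cφ}`, namely `A_k(C φ, …, C φ)`.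
    rw [hξ.integral_expVec_mul_mehler hS (hb k) (hbL k)]
    have h1 := IsHermiteValue.integral_expVec_mul (hα k) hξ e (C φ)
    rw [ContinuousMultilinearMap.compContinuousLinearMap_apply, ← h1]
    refine integral_congr_ae ?_
    filter_upwards [hαb k] with ω hω
    rw [hω]
  · exact hξ.memLp_mehler hS ha hL
  -- Contractivity bounds the error of the transformed series by that of the original one.
  · refine tendsto_of_tendsto_of_tendsto_of_le_of_le tendsto_const_nhds hsum.2
      (fun _ => zero_le) fun s => ?_
    have h1 : eLpNorm (fun ω => ∑ k ∈ s, α k ω - a fun φ => ξ φ ω) 2 P =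
        eLpNorm (fun ω => (fun z => ∑ k ∈ s, b k z - a z) fun φ => ξ φ ω) 2 P := by
      refine eLpNorm_congr_ae ?_
      filter_upwards [(Finset.eventually_all s).2 fun k _ => hαb k] with ω hω
      rw [Finset.sum_congr rfl hω]
    change eLpNorm (fun ω => ∑ k ∈ s, mehler P S C ξ (b k) ω - mehler P S C ξ a ω) 2 P ≤
      eLpNorm (fun ω => ∑ k ∈ s, α k ω - a fun φ => ξ φ ω) 2 P
    rw [h1, eLpNorm_congr_ae (hξ.sum_mehler_sub_ae_eq hS hb hbL ha hL s)]
    exact hξ.eLpNorm_mehler_le hS ((Finset.measurable_fun_sum s fun k _ => hb k).sub ha)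

end IsGenGaussian

end Mehler

/-! ### Weak convergence to a unit mass -/

section Dirac

variable {𝔛 : Type*} [TopologicalSpace 𝔛] [MeasurableSpace 𝔛] [BorelSpace 𝔛]

theorem abs_integral_sub_le_of_abs_sub_le (ν : Measure 𝔛) [IsProbabilityMeasure ν]
    (f : BoundedContinuousFunction 𝔛 ℝ) {B : Set 𝔛} (hB : MeasurableSet B) {ε c : ℝ} (hε : 0 ≤ ε)
    (hf : ∀ u ∈ B, |f u - c| ≤ ε) (hc : |c| ≤ ‖f‖) :
    |∫ u, f u ∂ν - c| ≤ ε + 2 * ‖f‖ * (1 - ν.real B) := by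
  have hi := f.integrable ν
  have h1 : ∫ u, f u ∂ν - c = ∫ u, (f u - c) ∂ν := by
    rw [integral_sub hi (integrable_const c)]; simp
  have h2 : ∀ u, |f u - c| ≤ ε + Bᶜ.indicator (fun _ => 2 * ‖f‖) u := by
    intro u
    by_cases hu : u ∈ B
    · simpa [hu] using hf u hu
    · have h3 : |f u| ≤ ‖f‖ := f.norm_coe_le_norm u
      have h4 := abs_sub (f u) c
      simp only [Set.mem_compl_iff, hu, not_false_eq_true, Set.indicator_of_mem]
      linarith
  rw [h1]
  refine (abs_integral_le_integral_abs).trans ?_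
  refine (integral_mono (hi.sub (integrable_const c)).abs
    ((integrable_const ε).add ((integrable_const _).indicator hB.compl)) h2).trans_eq ?_
  rw [integral_add' (integrable_const _) ((integrable_const _).indicator hB.compl),
    integral_indicator hB.compl, setIntegral_const, probReal_compl_eq_one_sub hB]
  simp [mul_comm]

/-- Probability measures converge weakly to the unit mass at `y` as soon as the masses of the
elements of a base of the topology converge. -/
theorem tendsto_integral_of_tendsto_indicator {b : Set (Set 𝔛)}
    (hb : TopologicalSpace.IsTopologicalBasis b) {ν : ℕ → Measure 𝔛}
    [∀ n, IsProbabilityMeasure (ν n)] {y : 𝔛}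
    (h : ∀ B ∈ b, Tendsto (fun n => (ν n).real B) atTop (𝓝 (B.indicator (fun _ => 1) y)))
    (f : BoundedContinuousFunction 𝔛 ℝ) :
    Tendsto (fun n => ∫ u, f u ∂ν n) atTop (𝓝 (f y)) := by
  rw [Metric.tendsto_atTop']
  intro ε hε
  obtain ⟨B, hBb, hyB, hB⟩ := hb.mem_nhds_iff.1
    (f.continuous.continuousAt.preimage_mem_nhds (Metric.ball_mem_nhds (f y) (half_pos hε)))
  have h1 := h B hBb
  rw [Set.indicator_of_mem hyB] at h1
  have h2 : Tendsto (fun n => ε / 2 + 2 * ‖f‖ * (1 - (ν n).real B)) atTop (𝓝 (ε / 2)) := by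
    simpa using ((h1.const_sub 1).const_mul (2 * ‖f‖)).const_add (ε / 2)
  obtain ⟨N, hN⟩ := eventually_atTop.1 (h2.eventually_lt_const (half_lt_self hε))
  refine ⟨N, fun n hn => (abs_integral_sub_le_of_abs_sub_le (ν n) f (hb.isOpen hBb).measurableSet
    (half_pos hε).le (fun u hu => ?_) (f.norm_coe_le_norm y)).trans_lt (hN n hn.le)⟩
  have := hB hu
  rw [Set.mem_preimage, Metric.mem_ball, Real.dist_eq] at this
  exact this.le

end Dirac

/-! ### Finite sections, Lévy's theorem and substitution -/

namespace IsGenGaussian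

variable {Ω : Type*} [MeasurableSpace Ω] {P : Measure Ω} [IsProbabilityMeasure P]
  {H : Type*} [NormedAddCommGroup H] [InnerProductSpace ℝ H] {ξ : H → Ω → ℝ} {ι : Type}

theorem eLpNorm_eq (hξ : IsGenGaussian P ξ) (φ : H) : eLpNorm (ξ φ) 2 P = ENNReal.ofReal ‖φ‖ := by
  rw [(hξ.memLp_two φ).eLpNorm_eq_integral_rpow_norm (by norm_num) (by norm_num)]
  congr 1
  have h1 : ∀ ω, ‖ξ φ ω‖ ^ (2 : ENNReal).toReal = ξ φ ω ^ 2 := fun ω => by simp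
  simp_rw [h1, hξ.integral_sq]
  rw [ENNReal.toReal_ofNat, ← Real.rpow_natCast, ← Real.rpow_mul (norm_nonneg _)]
  norm_num

theorem hasSumL2_basis (hξ : IsGenGaussian P ξ) (e : HilbertBasis ι ℝ H) (φ : H) :
    HasSumL2 P (fun l ω => inner ℝ (e l) φ * ξ (e l) ω) (ξ φ) := by
  refine ⟨hξ.memLp_two φ, ?_⟩
  have h1 : ∀ s : Finset ι, eLpNorm (fun ω => ∑ l ∈ s, inner ℝ (e l) φ * ξ (e l) ω - ξ φ ω) 2 P =
      ENNReal.ofReal ‖∑ l ∈ s, inner ℝ (e l) φ • e l - φ‖ := by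
    intro s
    rw [← hξ.eLpNorm_eq]
    refine eLpNorm_congr_ae ?_
    filter_upwards [hξ.linear 1 (-1) (∑ l ∈ s, inner ℝ (e l) φ • e l) φ,
      hξ.isExpField.sum s (fun l => inner ℝ (e l) φ) e] with ω h2 h3
    rw [h3] at h2
    rw [sub_eq_add_neg (∑ l ∈ s, _ • _) φ, ← neg_one_smul ℝ φ]
    rw [one_smul] at h2
    rw [h2]; ring
  simp_rw [h1]
  have h2 : HasSum (fun l => inner ℝ (e l) φ • e l) φ := by
    simpa [e.repr_apply_apply] using e.hasSum_repr φ
  simpa using ENNReal.tendsto_ofReal ((h2.sub_const φ).norm)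

end IsGenGaussian

section FiniteSection

variable {Ω : Type*} {H : Type*} [NormedAddCommGroup H] [InnerProductSpace ℝ H]
  [TopologicalSpace.SeparableSpace H] [MeasurableSpace H] [BorelSpace H] {ι : Type}

theorem measurable_finsetSum_smul (e : HilbertBasis ι ℝ H) (F : Finset ι) :
    Measurable fun z : H → ℝ => ∑ j ∈ F, z (e j) • e j := by
  have := UniformSpace.secondCountable_of_separable H
  exact Finset.measurable_fun_sum F fun j _ => (measurable_pi_apply (e j)).smul_const (e j)

theorem inner_finiteSection (ξ : H → Ω → ℝ) (e : HilbertBasis ι ℝ H) {F : Finset ι} {j : ι}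
    (hj : j ∈ F) (ω : Ω) : inner ℝ (e j) (finiteSection ξ e F ω) = ξ (e j) ω :=
  e.orthonormal.inner_right_sum (fun i => ξ (e i) ω) hj

theorem comap_finiteSection_mono (ξ : H → Ω → ℝ) (e : HilbertBasis ι ℝ H) {F G : Finset ι}
    (hFG : F ⊆ G) :
    MeasurableSpace.comap (finiteSection ξ e F) inferInstance ≤
      MeasurableSpace.comap (finiteSection ξ e G) inferInstance := by
  have := UniformSpace.secondCountable_of_separable H
  have h1 : finiteSection ξ e F =
      (fun h : H => ∑ j ∈ F, inner ℝ (e j) h • e j) ∘ finiteSection ξ e G := by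
    ext ω
    simp only [Function.comp_apply]
    rw [finiteSection]
    exact Finset.sum_congr rfl fun j hj => by rw [inner_finiteSection ξ e (hFG hj)]
  have h2 : Measurable fun h : H => ∑ j ∈ F, inner ℝ (e j) h • e j := by fun_prop
  rw [h1, ← MeasurableSpace.comap_comp]
  exact MeasurableSpace.comap_mono h2.comap_le

variable [MeasurableSpace Ω] {P : Measure Ω} [IsProbabilityMeasure P] {ξ : H → Ω → ℝ}

namespace IsGenGaussian

theorem measurable_finiteSection (hξ : IsGenGaussian P ξ) (e : HilbertBasis ι ℝ H)
    (F : Finset ι) : Measurable (finiteSection ξ e F) :=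
  (measurable_finsetSum_smul e F).comp hξ.measurable_field

/-- The filtration generated by the finite sections of `ξ`. -/
noncomputable def sectionFiltration (hξ : IsGenGaussian P ξ) (e : HilbertBasis ι ℝ H) {F : ℕ → Finset ι}
    (hF : Monotone F) : Filtration ℕ ‹MeasurableSpace Ω› where
  seq n := MeasurableSpace.comap (finiteSection ξ e (F n)) inferInstance
  mono' _ _ h := comap_finiteSection_mono ξ e (hF h)
  le' n := (hξ.measurable_finiteSection e (F n)).comap_le

/-- Each `(φ, ξ)` is a square-mean limit of combinations of the coordinates, hence a function of
them only up to a null set; this is why the completed sigma-field appears. -/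
theorem sigmaOf_le_eventuallyMeasurableSpace (hξ : IsGenGaussian P ξ) (e : HilbertBasis ι ℝ H)
    {F : ℕ → Finset ι} (hF : Monotone F) (hex : ∀ j, ∃ n, j ∈ F n) :
    sigmaOf ξ ≤ eventuallyMeasurableSpace (⨆ n, hξ.sectionFiltration e hF n) (ae P) := by
  refine iSup_le fun φ => ?_
  have hle : ⨆ n, hξ.sectionFiltration e hF n ≤ ‹MeasurableSpace Ω› :=
    iSup_le fun n => (hξ.sectionFiltration e hF).le n
  have h1 : ∀ j, Measurable[⨆ n, hξ.sectionFiltration e hF n] (ξ (e j)) := by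
    intro j
    obtain ⟨n, hn⟩ := hex j
    have h2 : ξ (e j) = (fun h : H => inner ℝ (e j) h) ∘ finiteSection ξ e (F n) := by
      ext ω
      exact (inner_finiteSection ξ e hn ω).symm
    have h3 : Measurable[hξ.sectionFiltration e hF n] (ξ (e j)) := by
      rw [h2]
      have h4 : Measurable fun h : H => inner ℝ (e j) h :=
        (continuous_const.inner continuous_id).measurable
      exact h4.comp (comap_measurable _)
    exact h3.mono (le_iSup _ n) le_rfl
  have h5 : AEStronglyMeasurable[⨆ n, hξ.sectionFiltration e hF n] (ξ φ) P :=
    HasSumL2.aestronglyMeasurable hle (fun l => (hξ.memLp_two (e l)).const_mul (inner ℝ (e l) φ))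
      (fun l => ((h1 l).const_mul _).stronglyMeasurable.aestronglyMeasurable)
      (hξ.hasSumL2_basis e φ)
  obtain ⟨g, hg, hgξ⟩ := h5
  exact (hg.measurable.eventuallyMeasurable_of_eventuallyEq hgξ).comap_le

variable {𝔛 : Type*} [MeasurableSpace 𝔛] {x : Ω → 𝔛}

/-- Lévy's upward theorem for the conditional laws given the finite sections. -/
theorem tendsto_condLaw_real (hξ : IsGenGaussian P ξ) (hx : Measurable[sigmaOf ξ] x)
    (e : HilbertBasis ι ℝ H) {F : ℕ → Finset ι} (hF : Monotone F) (hex : ∀ j, ∃ n, j ∈ F n)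
    {ν : ℕ → Kernel H 𝔛} (hν : ∀ n, IsCondLaw P x (finiteSection ξ e (F n)) (ν n))
    {B : Set 𝔛} (hB : MeasurableSet B) :
    ∀ᵐ ω ∂P, Tendsto (fun n => (ν n (finiteSection ξ e (F n) ω)).real B) atTop
      (𝓝 (B.indicator (fun _ => 1) (x ω))) := by
  have hle : ⨆ n, hξ.sectionFiltration e hF n ≤ ‹MeasurableSpace Ω› :=
    iSup_le fun n => (hξ.sectionFiltration e hF).le n
  have hs : MeasurableSet (x ⁻¹' B) := hξ.sigmaOf_le _ (hx hB)
  -- Up to a null set the event belongs to the limit sigma-field, so the limiting conditional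
  -- probability is its indicator.
  obtain ⟨t, ht, hst⟩ := hξ.sigmaOf_le_eventuallyMeasurableSpace e hF hex _ (hx hB)
  have h1 : AEStronglyMeasurable[⨆ n, hξ.sectionFiltration e hF n]
      ((x ⁻¹' B).indicator fun _ => (1 : ℝ)) P :=
    ⟨t.indicator fun _ => 1, stronglyMeasurable_const.indicator ht,
      indicator_ae_eq_of_ae_eq_set hst⟩
  have h2 := condExp_of_aestronglyMeasurable' hle h1 ((integrable_const (1 : ℝ)).indicator hs)
  have h3 := tendsto_ae_condExp (μ := P) (ℱ := hξ.sectionFiltration e hF)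
    ((x ⁻¹' B).indicator fun _ => (1 : ℝ))
  have h4 := ae_all_iff.2 fun n => (hν n).2 B hB
  filter_upwards [h2, h3, h4] with ω h2 h3 h4
  rw [h2] at h3
  exact h3.congr fun n => (h4 n).symm

end IsGenGaussian

/-- A functional of `ξ` can be evaluated at every field `η` with the law of `ξ`. -/
theorem IsGenGaussian.isSubstitution_comp [CompleteSpace H] {𝔛 : Type*} [TopologicalSpace 𝔛]
    [SecondCountableTopology 𝔛] [MeasurableSpace 𝔛] [BorelSpace 𝔛]
    (hξ : IsGenGaussian P ξ) {η : H → Ω → ℝ} (hη : Measurable fun ω φ => η φ ω)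
    (hmap : P.map (fun ω φ => η φ ω) = P.map fun ω φ => ξ φ ω) {X : (H → ℝ) → 𝔛}
    (hX : Measurable X) :
    IsSubstitution P ξ η (fun ω => X fun φ => ξ φ ω) fun ω => X fun φ => η φ ω := by
  refine ⟨hX.comp (IsGenGaussian.measurable_field_sigmaOf η), fun e F hF hex ν hν => ?_⟩
  -- A countable base allows one null set to serve all `B`, and then all `f`.
  have key : ∀ B ∈ TopologicalSpace.countableBasis 𝔛, ∀ᵐ ω ∂P,
      Tendsto (fun n => (ν n (finiteSection η e (F n) ω)).real B) atTop
        (𝓝 (B.indicator (fun _ => 1) (X fun φ => η φ ω))) := by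
    intro B hBb
    have hB : MeasurableSet B := (TopologicalSpace.isOpen_of_mem_countableBasis hBb).measurableSet
    have h1 := hξ.tendsto_condLaw_real (hX.comp (IsGenGaussian.measurable_field_sigmaOf ξ)) e hF hex hν hB
    -- Convergence is an event of the path `z` alone, so it has the same probability for `ξ` and
    -- `η`.
    have h2 : MeasurableSet {z : H → ℝ | Tendsto
        (fun n => (ν n (∑ j ∈ F n, z (e j) • e j)).real B) atTop
        (𝓝 (B.indicator (fun _ => 1) (X z)))} :=
      measurableSet_tendsto_fun
        (fun n => (((ν n).measurable_coe hB).comp (measurable_finsetSum_smul e (F n))).ennreal_toReal)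
        ((measurable_const.indicator hB).comp hX)
    have h3 := (ae_map_iff hξ.measurable_field.aemeasurable h2).2 h1
    rw [← hmap] at h3
    exact (ae_map_iff hη.aemeasurable h2).1 h3
  filter_upwards [(ae_ball_iff (TopologicalSpace.countable_countableBasis 𝔛)).2 key] with ω hω f
  have := fun n => (hν n).1
  exact tendsto_integral_of_tendsto_indicator (TopologicalSpace.isBasis_countableBasis 𝔛) hω f

end FiniteSection

/-! ### Kernels given by random maps -/

section RandomMap

variable {Z Ω 𝔛 : Type*} [MeasurableSpace Z] [MeasurableSpace Ω] [MeasurableSpace 𝔛]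

/-- The kernel of the laws of `F (z, ·)`. -/
noncomputable def mapKernel (P : Measure Ω) [SFinite P] {F : Z × Ω → 𝔛} (hF : Measurable F) :
    Kernel Z 𝔛 where
  toFun z := P.map fun ω => F (z, ω)
  measurable' := by
    refine Measure.measurable_of_measurable_coe _ fun s hs => ?_
    have h1 : ∀ z, P.map (fun ω => F (z, ω)) s = P (Prod.mk z ⁻¹' (F ⁻¹' s)) := fun z =>
      Measure.map_apply (hF.comp measurable_prodMk_left) hs
    simp_rw [h1]
    exact measurable_measure_prodMk_left (hF hs)

theorem mapKernel_apply (P : Measure Ω) [SFinite P] {F : Z × Ω → 𝔛} (hF : Measurable F) (z : Z) :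
    mapKernel P hF z = P.map fun ω => F (z, ω) := rfl

theorem isMarkovKernel_mapKernel (P : Measure Ω) [IsProbabilityMeasure P] {F : Z × Ω → 𝔛}
    (hF : Measurable F) : IsMarkovKernel (mapKernel P hF) :=
  ⟨fun _ => Measure.isProbabilityMeasure_map (hF.comp measurable_prodMk_left).aemeasurable⟩

end RandomMap

/-! ### Joint law of `ξ` and `η`, and the conditional law -/

namespace IsGenGaussian

variable {Ω : Type*} [MeasurableSpace Ω] {P : Measure Ω} [IsProbabilityMeasure P]
  {H : Type*} [NormedAddCommGroup H] [InnerProductSpace ℝ H] [CompleteSpace H] {ξ ξ' : H → Ω → ℝ}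
  {C S T : H →L[ℝ] H}

theorem measurable_mixture (hξ : IsGenGaussian P ξ) (hξ' : IsGenGaussian P ξ') :
    Measurable fun ω φ => mixture T C ξ' ξ φ ω :=
  measurable_pi_lambda _ fun _ => (hξ'.measurable _).add (hξ.measurable _)

theorem measurable_prodMk_mehlerField (hξ : IsGenGaussian P ξ) :
    Measurable fun p : Ω × Ω => ((fun φ => ξ φ p.1), fun φ => mehlerField S C ξ φ p) :=
  (hξ.measurable_field.comp measurable_fst).prodMk hξ.measurable_mehlerField

/-- The joint law of `ξ` and `η`. -/
theorem map_prodMk_mixture (hξ : IsGenGaussian P ξ) (hξ' : IsGenGaussian P ξ')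
    (hind : Indep (sigmaOf ξ) (sigmaOf ξ') P) (hTS : ∀ φ, ‖T φ‖ = ‖S φ‖) :
    P.map (fun ω => ((fun φ => ξ φ ω), fun φ => mixture T C ξ' ξ φ ω)) =
      (P.prod P).map fun p => ((fun φ => ξ φ p.1), fun φ => mehlerField S C ξ φ p) := by
  have hT := hξ'.isExpField.comp_linear T.toLinearMap
  have hS := hξ.isExpField.comp_linear S.toLinearMap
  have mT : Measurable fun ω φ => ξ' (T φ) ω := hT.measurable_field
  have mS : Measurable fun ω φ => ξ (S φ) ω := hS.measurable_field
  have hlaw : P.map (fun ω φ => ξ' (T φ) ω) = P.map fun ω φ => ξ (S φ) ω :=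
    -- Equal norms give equal exponential moments, so `T` and `S` need not coincide.
    hT.map_eq hS fun φ => (hξ'.integral_exp (T φ)).trans (by rw [hTS]; exact (hξ.integral_exp _).symm)
  have h1 : IndepFun (fun ω φ => ξ φ ω) (fun ω φ => ξ' φ ω) P := by
    rw [IndepFun_iff_Indep]
    rwa [sigmaOf_eq_comap, sigmaOf_eq_comap] at hind
  have hcomp : Measurable fun (w : H → ℝ) φ => w (T φ) :=
    measurable_pi_lambda _ fun φ => measurable_pi_apply _
  have h2 : IndepFun (fun ω φ => ξ φ ω) (fun ω φ => ξ' (T φ) ω) P :=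
    h1.comp measurable_id hcomp
  have h3 := (indepFun_iff_map_prod_eq_prod_map_map hξ.measurable_field.aemeasurable
    mT.aemeasurable).1 h2
  have hG : Measurable fun p : (H → ℝ) × (H → ℝ) =>
      (p.1, fun φ => p.1 (ContinuousLinearMap.adjoint C φ) + p.2 φ) :=
    measurable_fst.prodMk (measurable_pi_lambda _ fun φ =>
      ((measurable_pi_apply _).comp measurable_fst).add
        ((measurable_pi_apply _).comp measurable_snd))
  have h5 : P.map (fun ω => ((fun φ => ξ φ ω), fun φ => ξ' (T φ) ω)) =
      (P.prod P).map (Prod.map (fun ω φ => ξ φ ω) fun ω φ => ξ (S φ) ω) := by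
    rw [← Measure.map_prod_map P P hξ.measurable_field mS, ← hlaw]
    exact h3
  have h6 := congrArg (Measure.map fun p : (H → ℝ) × (H → ℝ) =>
      (p.1, fun φ => p.1 (ContinuousLinearMap.adjoint C φ) + p.2 φ)) h5
  rw [Measure.map_map hG (hξ.measurable_field.prodMk mT),
    Measure.map_map hG (hξ.measurable_field.prodMap mS)] at h6
  refine Eq.trans ?_ h6
  congr 1
  ext ω : 1
  simp [mixture, add_comm]

theorem map_mixture (hξ : IsGenGaussian P ξ) (hξ' : IsGenGaussian P ξ')
    (hind : Indep (sigmaOf ξ) (sigmaOf ξ') P) (hTS : ∀ φ, ‖T φ‖ = ‖S φ‖)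
    (hS : ∀ φ, ‖ContinuousLinearMap.adjoint C φ‖ ^ 2 + ‖S φ‖ ^ 2 = ‖φ‖ ^ 2) :
    P.map (fun ω φ => mixture T C ξ' ξ φ ω) = P.map fun ω φ => ξ φ ω := by
  have h1 := congrArg (Measure.map Prod.snd)
    (hξ.map_prodMk_mixture (C := C) hξ' hind hTS)
  rw [Measure.map_map measurable_snd (hξ.measurable_field.prodMk (hξ.measurable_mixture hξ')),
    Measure.map_map measurable_snd hξ.measurable_prodMk_mehlerField] at h1
  exact h1.trans (hξ.map_mehlerField hS)

/-- Mehler's formula gives the conditional expectation given `ξ` of the functional evaluated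
at `η`. -/
theorem mehler_ae_eq_condExp (hξ : IsGenGaussian P ξ) (hξ' : IsGenGaussian P ξ')
    (hind : Indep (sigmaOf ξ) (sigmaOf ξ') P) (hTS : ∀ φ, ‖T φ‖ = ‖S φ‖)
    (hS : ∀ φ, ‖ContinuousLinearMap.adjoint C φ‖ ^ 2 + ‖S φ‖ ^ 2 = ‖φ‖ ^ 2)
    {a : (H → ℝ) → ℝ} (ha : Measurable a) (hL : MemLp (fun ω => a fun φ => ξ φ ω) 2 P) :
    mehler P S C ξ a =ᵐ[P] P[fun ω => a fun φ => mixture T C ξ' ξ φ ω | sigmaOf ξ] := by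
  have hη := hξ.measurable_mixture (C := C) (T := T) hξ'
  have hint : Integrable (fun ω => a fun φ => mixture T C ξ' ξ φ ω) P := by
    have h1 := (integrable_map_measure (f := fun ω φ => ξ φ ω) ha.aestronglyMeasurable
      hξ.measurable_field.aemeasurable).2 (hL.integrable (by norm_num))
    rw [← hξ.map_mixture hξ' hind hTS hS] at h1
    exact (integrable_map_measure ha.aestronglyMeasurable hη.aemeasurable).1 h1
  refine ae_eq_condExp_of_forall_setIntegral_eq hξ.sigmaOf_le hint
    (fun s _ _ => ((hξ.memLp_mehler hS ha hL).integrable (by norm_num)).integrableOn)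
    (fun s hs _ => ?_) (hξ.stronglyMeasurable_mehler ha).aestronglyMeasurable
  rw [sigmaOf_eq_comap] at hs
  obtain ⟨B, hB, rfl⟩ := hs
  have h1 := hξ.map_prodMk_mixture (C := C) hξ' hind hTS
  have h2 : MeasurableSet (B ×ˢ (Set.univ : Set (H → ℝ))) := hB.prod .univ
  have ha2 : Measurable fun p : (H → ℝ) × (H → ℝ) => a p.2 := ha.comp measurable_snd
  -- An event of `σ(ξ)` is a cylinder over the first coordinate of the pair, so the joint law
  -- determines the integral over it; on the product space that integral is iterated.
  have h3 := congrArg (fun Q => ∫ p in B ×ˢ Set.univ, a p.2 ∂Q) h1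
  rw [setIntegral_map h2 ha2.aestronglyMeasurable (hξ.measurable_field.prodMk hη).aemeasurable,
    setIntegral_map h2 ha2.aestronglyMeasurable
      hξ.measurable_prodMk_mehlerField.aemeasurable] at h3
  have h4 : (fun ω => ((fun φ => ξ φ ω), fun φ => mixture T C ξ' ξ φ ω)) ⁻¹' (B ×ˢ Set.univ) =
      (fun ω φ => ξ φ ω) ⁻¹' B := by ext; simp
  have h5 : (fun p : Ω × Ω => ((fun φ => ξ φ p.1), fun φ => mehlerField S C ξ φ p)) ⁻¹'
      (B ×ˢ Set.univ) = ((fun ω φ => ξ φ ω) ⁻¹' B) ×ˢ Set.univ := by ext; simp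
  rw [h4, h5, setIntegral_prod _
    ((hξ.memLp_comp_mehlerField hS ha hL).integrable (by norm_num)).integrableOn] at h3
  simp only [Measure.restrict_univ] at h3
  exact h3.symm

end IsGenGaussian

/-! ### Assembly -/

theorem corollary1p1
    {Ω : Type*} [MeasurableSpace Ω] (P : Measure Ω) [IsProbabilityMeasure P]
    {H : Type*} [NormedAddCommGroup H] [InnerProductSpace ℝ H] [CompleteSpace H]
    [TopologicalSpace.SeparableSpace H] [MeasurableSpace H] [BorelSpace H]
    {𝔛 : Type*} [TopologicalSpace 𝔛] [PolishSpace 𝔛] [MeasurableSpace 𝔛] [BorelSpace 𝔛]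
    (ξ : H → Ω → ℝ) (hξ : IsGenGaussian P ξ)
    (C : H →L[ℝ] H) (hC : ‖C‖ ≤ 1)
    (x : Ω → 𝔛) (hx : Measurable[sigmaOf ξ] x) :
    ∃ μ : Kernel[sigmaOf ξ] Ω 𝔛, IsMarkovKernel μ ∧
      -- the integrals against `μ` are the second quantizations
      (∀ f : 𝔛 → ℝ, Measurable f → (∃ M, ∀ u, |f u| ≤ M) →
        IsSecondQuantization P ξ C (fun ω => f (x ω)) (fun ω => ∫ u, f u ∂(μ ω))) ∧
      -- `μ` is the conditional law of `x(η)` given `ξ`, with `S = √(1 - C C*)`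
      (∀ S : H →L[ℝ] H, S.IsPositive → S ∘L S = 1 - C ∘L ContinuousLinearMap.adjoint C →
        ∀ ξ' : H → Ω → ℝ, IsGenGaussian P ξ' → Indep (sigmaOf ξ) (sigmaOf ξ') P →
          ∃ y : Ω → 𝔛, IsSubstitution P ξ (mixture S C ξ' ξ) x y ∧
            ∀ Δ : Set 𝔛, MeasurableSet Δ →
              (fun ω => (μ ω).real Δ) =ᵐ[P] P⟦y ⁻¹' Δ | sigmaOf ξ⟧) := by
  -- A point of `𝔛` is needed to factor `x` through a map defined on all of `H → ℝ`.
  have : Nonempty 𝔛 := (nonempty_of_isProbabilityMeasure P).map x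
  obtain ⟨X, hX, rfl⟩ : ∃ X : (H → ℝ) → 𝔛, Measurable X ∧ x = fun ω => X fun φ => ξ φ ω := by
    rw [sigmaOf_eq_comap] at hx
    obtain ⟨X, hX, h⟩ := hx.exists_eq_measurable_comp
    exact ⟨X, hX, h⟩
  obtain ⟨S, hSs, hSC⟩ := exists_sqrt_one_sub_comp_adjoint C hC
  have hS := norm_sq_add_norm_sq_of_sqrt hSs hSC
  have hF : Measurable fun p : (H → ℝ) × Ω =>
      X fun φ => p.1 (ContinuousLinearMap.adjoint C φ) + ξ (S φ) p.2 :=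
    hX.comp (measurable_pi_lambda _ fun φ => ((measurable_pi_apply _).comp measurable_fst).add
      ((hξ.measurable _).comp measurable_snd))
  have hK := isMarkovKernel_mapKernel P hF
  have hΞ := IsGenGaussian.measurable_field_sigmaOf ξ
  have hint : ∀ (f : 𝔛 → ℝ), Measurable f → ∀ ω,
      ∫ u, f u ∂(mapKernel P hF fun φ => ξ φ ω) = mehler P S C ξ (f ∘ X) ω := fun f hf ω => by
    rw [mapKernel_apply]
    exact integral_map (hF.comp measurable_prodMk_left).aemeasurable hf.aestronglyMeasurable
  have hL : ∀ f : 𝔛 → ℝ, Measurable f → (∃ M, ∀ u, |f u| ≤ M) →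
      MemLp (fun ω => (f ∘ X) fun φ => ξ φ ω) 2 P := fun f hf ⟨M, hM⟩ =>
    MemLp.of_bound ((hf.comp hX).comp hξ.measurable_field).aestronglyMeasurable M
      (ae_of_all _ fun ω => hM _)
  -- The kernel sees `ω` only through the path of `ξ`, which makes it `σ(ξ)`-measurable.
  refine ⟨(mapKernel P hF).comap _ hΞ, Kernel.IsMarkovKernel.comap _ hΞ,
    fun f hf hb => ?_, fun T hT hTC ξ' hξ' hind => ?_⟩
  · obtain ⟨ι, ⟨e⟩⟩ := exists_countable_hilbertBasis H
    simp only [Kernel.comap_apply, hint f hf]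
    exact ⟨hξ.exists_isItoWienerExpansion e (hL f hf hb)
      ((hf.comp hX).comp hΞ).stronglyMeasurable.aestronglyMeasurable,
      fun A hA => hξ.isItoWienerExpansion_mehler hC hS (hf.comp hX) (hL f hf hb) hA⟩
  -- The kernel was built from `S`, the mixture uses `T`. Both satisfy the same norm identity, and
  -- this suffices without uniqueness of the square root.
  · have hTS : ∀ φ, ‖T φ‖ = ‖S φ‖ := fun φ => by
      have h1 := norm_sq_add_norm_sq_of_sqrt hT.isSelfAdjoint hTC φ
      rw [← hS φ] at h1
      exact (sq_eq_sq₀ (norm_nonneg _) (norm_nonneg _)).1 (add_left_cancel h1)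
    refine ⟨fun ω => X fun φ => mixture T C ξ' ξ φ ω, hξ.isSubstitution_comp
      (hξ.measurable_mixture hξ') (hξ.map_mixture hξ' hind hTS hS) hX, fun Δ hΔ => ?_⟩
    have hf : Measurable (Δ.indicator fun _ => (1 : ℝ)) := measurable_const.indicator hΔ
    have h1 := hξ.mehler_ae_eq_condExp hξ' hind hTS hS (hf.comp hX)
      (hL _ hf ⟨1, fun u => by by_cases hu : u ∈ Δ <;> simp [hu]⟩)
    have h2 : ∀ ω, ((mapKernel P hF).comap _ hΞ ω).real Δ =
        mehler P S C ξ ((Δ.indicator fun _ => (1 : ℝ)) ∘ X) ω := fun ω => by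
      rw [← hint _ hf, integral_indicator hΔ, setIntegral_const, smul_eq_mul, mul_one,
        Kernel.comap_apply]
    simp only [h2]
    exact h1
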